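/- **Definitions.** An *effect algebra* $(\mathcal E,0,1,\oplus)$ is a set with elements $0\ne 1$ and a partial binary operation $\oplus$ (write $a\perp b$ if $a\oplus b$ is defined) such that: if $a\perp b$ then $b\perp a$ and $b\oplus a=a\oplus b$; if $a\perp b$ and $(a\oplus b)\perp c$ then $b\perp c$, $a\perp(b\oplus c)$ and $a\oplus(b\oplus c)=(a\oplus b)\oplus c$; for every $a$ there is a unique $a'$ with $a\perp a'$ and $a\oplus a'=1$; and $a\perp 1$ implies $a=0$. It is *convex* if it carries a multiplication $[0,1]\times\mathcal E\to\mathcal E$, $(\lambda,a)\mapsto\lambda a$, such that $\alpha(\beta a)=(\alpha\beta)a$; $\alpha a\perp\beta a$ and $(\alpha+\beta)a=\alpha a\oplus\beta a$ whenever $\alpha+\beta\le 1$; $\lambda a\perp\lambda b$ and $\lambda(a\oplus b)=\lambda a\oplus\lambda b$ whenever $a\perp b$; and $1a=a$. Put $a\le b$ if $a\oplus c=b$ for some $c$. A *morphism* $\phi:\mathcal E\to\mathcal F$ satisfies $\phi(1)=1$ and, whenever $a\perp b$, $\phi(a)\perp\phi(b)$ and $\phi(a\oplus b)=\phi(a)\oplus\phi(b)$.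 An *affine isomorphism* is a surjective morphism with $\phi(\lambda a)=\lambda\phi(a)$ for all $\lambda\in[0,1]$ such that $\phi(a)\perp\phi(b)$ implies $a\perp b$. A *state* is a morphism into $[0,1]\subseteq\mathbb R$ (where $a\oplus b=a+b$ if $a+b\le1$). For a nonzero complex Hilbert space $H$, the *Hilbertian effect algebra* $\mathcal E(H)$ is the set of operators $0\le A\le I$ on $H$ with $A\oplus B=A+B$, defined if $A+B\le I$, and the usual scalar multiplication. An effect $a$ is *sharp* if the greatest lower bound of $a$ and $a'$ is $0$; a sharp $a\neq0$ is *one-dimensional* if every $b\le a$ is of the form $b=\lambda a$, $\lambda\in[0,1]$. For every one-dimensional sharp effect $a$ choose a state $\widehat a$ with $\widehat a(a)=1$. A *context* is a finite set $\{a_1,\dots,a_n\}$ of one-dimensional sharp effects with $a_1\oplus\cdots\oplus a_n=1$. $\mathcal E$ is *finite-dimensional* if it has a context, and *spectral* if every $b\in\mathcal E$ has the form $b=\lambda_1a_1\oplus\cdots\oplus\lambda_na_n$ with $\lambda_i\in[0,1]$ for some context $\{a_1,\dots,a_n\}$. For a context $\mathcal A$, $\mathcal H(\mathcal A)$ is the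 complex Hilbert space with orthonormal basis $\{\widehat a: a\in\mathcal A\}$. The set of contexts of $\mathcal E$ is *complete* if there are unitary maps $U_{\mathcal A\mathcal B}:\mathcal H(\mathcal A)\to\mathcal H(\mathcal B)$, one for each pair of contexts, such that 1. $U_{\mathcal A\mathcal A}=I$ and $U_{\mathcal A\mathcal B}=U_{\mathcal B\mathcal A}^*$ for all contexts $\mathcal A,\mathcal B$; 2. $|\langle U_{\mathcal A\mathcal B}\widehat a,U_{\mathcal C\mathcal B}\widehat c\rangle|^2=\widehat a(c)$ for all contexts $\mathcal A,\mathcal B,\mathcal C$ and all $a\in\mathcal A$, $c\in\mathcal C$; 3. for every context $\mathcal B$ and every unit vector $\phi\in\mathcal H(\mathcal B)$ there are a context $\mathcal A$, an $a\in\mathcal A$ and a $z\in\mathbb C$ with $|z|=1$ such that $U_{\mathcal A\mathcal B}\widehat a=z\phi$. **Theorem.** Let $\mathcal E$ be a finite-dimensional convex effect algebra. Then $\mathcal E$ is affinely isomorphic to a Hilbertian effect algebra $\mathcal E(H)$, for some complex Hilbert space $H$, if and only if its set of contexts is complete and $\mathcal E$ is spectral. This holds for every choice of the states $\widehat a$,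 and also if completeness is required only for some choice of them. -/

import Mathlib

universe u v

/-- An effect algebra `(E, 0, 1, ⊕)`. The partial operation `⊕` is given by its domain `Orth`
(`a ⊥ b`, i.e. `a ⊕ b` is defined) and its value `osum a b h` on that domain. -/
class EffectAlgebra (E : Type u) extends Zero E, One E where
  Orth : E → E → Prop
  osum : ∀ a b : E, Orth a b → E
  zero_ne_one : (0 : E) ≠ 1
  osum_comm : ∀ (a b : E) (h : Orth a b), ∃ h' : Orth b a, osum b a h' = osum a b h
  osum_assoc : ∀ (a b c : E) (h : Orth a b) (h' : Orth (osum a b h) c),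
    ∃ (h₁ : Orth b c) (h₂ : Orth a (osum b c h₁)),
      osum a (osum b c h₁) h₂ = osum (osum a b h) c h'
  exists_unique_compl : ∀ a : E, ∃! a' : E, ∃ h : Orth a a', osum a a' h = 1
  eq_zero_of_orth_one : ∀ a : E, Orth a 1 → a = 0

/-- A convex effect algebra: an effect algebra with multiplication by scalars in `[0, 1]`. -/
class ConvexEffectAlgebra (E : Type u) extends EffectAlgebra E, SMul unitInterval E where
  smul_smul' : ∀ (α β : unitInterval) (a : E), α • (β • a) = (α * β) • a
  add_smul' : ∀ (α β γ : unitInterval) (a : E), (γ : ℝ) = α + β →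
    ∃ h : Orth (α • a) (β • a), γ • a = osum (α • a) (β • a) h
  smul_osum : ∀ (c : unitInterval) (a b : E) (h : Orth a b),
    ∃ h' : Orth (c • a) (c • b), c • osum a b h = osum (c • a) (c • b) h'
  one_smul' : ∀ a : E, (1 : unitInterval) • a = a

namespace EffectAlgebra

section Basic

variable {E : Type u} [EffectAlgebra E]

/-- `a ≤ b` iff `a ⊕ c = b` for some `c`. -/
def Le (a b : E) : Prop := ∃ (c : E) (h : Orth a c), osum a c h = b

/-- The orthosupplement `a'`: the unique element with `a ⊕ a' = 1`. -/
noncomputable def orthosupp (a : E) : E := (exists_unique_compl a).choose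

/-- `a` is sharp iff the greatest lower bound of `a` and `a'` is `0`. -/
def IsSharp (a : E) : Prop :=
  (Le 0 a ∧ Le 0 (orthosupp a)) ∧ ∀ b : E, Le b a → Le b (orthosupp a) → Le b 0

/-- `IsOrthoSum m s`: the orthogonal sum of the finite family `m` is defined and equals `s`. -/
inductive IsOrthoSum : Multiset E → E → Prop
  | zero : IsOrthoSum 0 0
  | cons (a : E) (m : Multiset E) (s : E) (hs : IsOrthoSum m s) (h : Orth a s) :
      IsOrthoSum (a ::ₘ m) (osum a s h)

end Basic

/-- `φ : E → F` is a morphism of effect algebras: additive and unital. -/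
structure IsMorphism {E : Type u} {F : Type v} [EffectAlgebra E] [EffectAlgebra F]
    (φ : E → F) : Prop where
  map_osum : ∀ (a b : E) (h : Orth a b), ∃ h' : Orth (φ a) (φ b),
    φ (osum a b h) = osum (φ a) (φ b) h'
  map_one : φ 1 = 1

/-- The unit interval `[0, 1] ⊆ ℝ`; `a ⊕ b = a + b`, defined when `a + b ≤ 1`. -/
instance : EffectAlgebra unitInterval where
  Orth a b := (a : ℝ) + b ≤ 1
  osum a b h := ⟨(a : ℝ) + b, add_nonneg a.2.1 b.2.1, h⟩
  zero_ne_one := _root_.zero_ne_one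
  osum_comm a b h := ⟨by simpa [add_comm] using h, by ext; simp [add_comm]⟩
  osum_assoc a b c h h' := by
    have ha := a.2.1
    simp only at h h'
    exact ⟨by linarith, by simp only; linarith, by ext; simp [add_assoc]⟩
  exists_unique_compl a := by
    refine ⟨unitInterval.symm a, ⟨by simp, by ext; simp⟩, ?_⟩
    rintro y ⟨h, hy⟩
    have := congrArg Subtype.val hy
    ext
    simp at this ⊢
    linarith
  eq_zero_of_orth_one a h := by
    have h0 := a.2.1
    have h1 : (a : ℝ) + 1 ≤ 1 := h
    exact Subtype.ext (le_antisymm (by simpa using h1) h0)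

/-- A state on `E` is a morphism `E → [0, 1]`. -/
def State (E : Type u) [EffectAlgebra E] : Type u := {ω : E → unitInterval // IsMorphism ω}

end EffectAlgebra

namespace ConvexEffectAlgebra

open EffectAlgebra

/-- `φ` is an affine isomorphism: an affine morphism that reflects `⊥` and is surjective. -/
structure IsAffineIso {E : Type u} {F : Type v} [ConvexEffectAlgebra E] [ConvexEffectAlgebra F]
    (φ : E → F) : Prop extends IsMorphism φ where
  orth_of_map : ∀ a b : E, Orth (φ a) (φ b) → Orth a b
  surjective : Function.Surjective φ
  map_smul : ∀ (c : unitInterval) (a : E), φ (c • a) = c • φ a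

/-- `E` and `F` are affinely isomorphic. -/
def AffinelyIsomorphic (E : Type u) (F : Type v) [ConvexEffectAlgebra E]
    [ConvexEffectAlgebra F] : Prop := ∃ φ : E → F, IsAffineIso φ

section Contexts

variable {E : Type u} [ConvexEffectAlgebra E]

/-- `a` is a one-dimensional sharp effect, `a ∈ S₁(E)`. -/
def IsOneDimSharp (a : E) : Prop :=
  IsSharp a ∧ a ≠ 0 ∧ ∀ b : E, Le b a → ∃ c : unitInterval, b = c • a

variable (E)

/-- A context: a finite set of one-dimensional sharp effects with orthogonal sum `1`. -/
structure Context where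
  carrier : Finset E
  isOneDimSharp : ∀ a ∈ carrier, IsOneDimSharp a
  sum_eq_one : IsOrthoSum carrier.val 1

/-- `E` is finite-dimensional iff there is a context on `E`. -/
def IsFiniteDimensional : Prop := Nonempty (Context E)

/-- `E` is spectral iff every `b` is `⊕ᵢ λᵢ aᵢ` with `λᵢ ∈ [0, 1]` for some context `{aᵢ}`. -/
def IsSpectral : Prop :=
  ∀ b : E, ∃ (A : Context E) (c : E → unitInterval),
    IsOrthoSum (A.carrier.val.map fun a => c a • a) b

/-- A choice, for every one-dimensional sharp effect `a`, of a state `â` with `â(a) = 1`. -/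
structure HatChoice where
  hat : ∀ a : E, IsOneDimSharp a → State E
  hat_self : ∀ (a : E) (ha : IsOneDimSharp a), (hat a ha).1 a = 1

variable {E}

/-- The state space `H(A)` of the context `A`: the complex Hilbert space of the formal
combinations `∑ αₐ â` (`a ∈ A`), with inner product `∑ conj αₐ * βₐ`. The states `â`, `a ∈ A`, are
linearly independent, as `â(b) = 0` for `b ∈ A`, `b ≠ a`; so a vector of the complex span
of the `â` is the same as its family of coordinates `αₐ`. -/
abbrev Context.stateSpace (A : Context E) : Type u := EuclideanSpace ℂ A.carrier

/-- The vector `â ∈ H(A)`, for `a ∈ A`. -/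
noncomputable def Context.vec (A : Context E) (a : A.carrier) : A.stateSpace :=
  open Classical in EuclideanSpace.single a 1

/-- The unitaries `U A B : H(A) → H(B)` compare the contexts of `E`. -/
structure IsComparison (κ : HatChoice E)
    (U : ∀ A B : Context E, A.stateSpace ≃ₗᵢ[ℂ] B.stateSpace) : Prop where
  refl : ∀ A : Context E, U A A = LinearIsometryEquiv.refl ℂ A.stateSpace
  /-- The inverse of a unitary is its adjoint. -/
  adjoint : ∀ A B : Context E, U A B = (U B A).symm
  transition : ∀ (A B C : Context E) (a : A.carrier) (c : C.carrier),
    ‖inner ℂ (U A B (A.vec a)) (U C B (C.vec c))‖ ^ 2 =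
      ((κ.hat a (A.isOneDimSharp a a.2)).1 c : ℝ)

/-- The set of all contexts of `E` is complete: the contexts are comparable through unitaries
`U A B` such that every unit vector of every `H(B)` is, up to a phase factor, some `U A B â`. -/
def IsComplete (κ : HatChoice E) : Prop :=
  ∃ U : ∀ A B : Context E, A.stateSpace ≃ₗᵢ[ℂ] B.stateSpace, IsComparison κ U ∧
    ∀ (B : Context E) (φ : B.stateSpace), ‖φ‖ = 1 →
      ∃ (A : Context E) (a : A.carrier) (z : ℂ), ‖z‖ = 1 ∧ U A B (A.vec a) = z • φ

end Contexts

end ConvexEffectAlgebra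

/-- The set `E(H)` of operators `A` on `H` with `0 ≤ A ≤ I` (in the Loewner order). -/
def HilbertEffect (H : Type u) [NormedAddCommGroup H] [InnerProductSpace ℂ H] : Type u :=
  {A : H →L[ℂ] H // 0 ≤ A ∧ A ≤ 1}

namespace HilbertEffect

variable {H : Type u} [NormedAddCommGroup H] [InnerProductSpace ℂ H]

theorem add_nonneg' {A B : H →L[ℂ] H} (hA : 0 ≤ A) (hB : 0 ≤ B) : 0 ≤ A + B := by
  rw [ContinuousLinearMap.nonneg_iff_isPositive] at *
  exact hA.add hB

theorem le_iff_sub_nonneg {A B : H →L[ℂ] H} : A ≤ B ↔ 0 ≤ B - A := by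
  rw [ContinuousLinearMap.nonneg_iff_isPositive, ContinuousLinearMap.le_def]

theorem smul_nonneg' {A : H →L[ℂ] H} (hA : 0 ≤ A) {c : ℝ} (hc : 0 ≤ c) : 0 ≤ (c : ℂ) • A := by
  rw [ContinuousLinearMap.nonneg_iff_isPositive] at *
  exact hA.smul_of_nonneg (RCLike.ofReal_nonneg.2 hc)

theorem zero_le_one' : (0 : H →L[ℂ] H) ≤ 1 := by
  rw [ContinuousLinearMap.nonneg_iff_isPositive]
  exact ContinuousLinearMap.isPositive_one

theorem smul_le_one' {A : H →L[ℂ] H} (hA : 0 ≤ A) (hA' : A ≤ 1) {c : ℝ} (hc : c ≤ 1) :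
    (c : ℂ) • A ≤ 1 := by
  rw [le_iff_sub_nonneg] at *
  have h := add_nonneg' hA' (smul_nonneg' hA (sub_nonneg.2 hc))
  convert h using 1
  push_cast
  module

/-- Scalar multiplication of operators by `c ∈ [0, 1]`. -/
noncomputable instance : SMul unitInterval (HilbertEffect H) where
  smul c A := ⟨((c : ℝ) : ℂ) • A.1, smul_nonneg' A.2.1 c.2.1, smul_le_one' A.2.1 A.2.2 c.2.2⟩

/-- `E(H)` as a convex effect algebra: `A ⊕ B = A + B`, defined when `A + B ≤ I`. The space `H`
is nonzero, so that `0 ≠ I`. -/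
noncomputable instance [Nontrivial H] : ConvexEffectAlgebra (HilbertEffect H) where
  zero := ⟨0, le_rfl, zero_le_one'⟩
  one := ⟨1, zero_le_one', le_rfl⟩
  Orth A B := A.1 + B.1 ≤ 1
  osum A B h := ⟨A.1 + B.1, add_nonneg' A.2.1 B.2.1, h⟩
  zero_ne_one h := zero_ne_one (α := H →L[ℂ] H) (congrArg Subtype.val h)
  osum_comm A B h := ⟨by rwa [add_comm], Subtype.ext (add_comm _ _)⟩
  osum_assoc A B C h h' := by
    have h₂ : A.1 + (B.1 + C.1) ≤ 1 := by rw [← add_assoc]; exact h'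
    have h₁ : B.1 + C.1 ≤ 1 := by
      rw [le_iff_sub_nonneg] at h₂ ⊢
      have := add_nonneg' h₂ A.2.1
      convert this using 1
      abel
    exact ⟨h₁, h₂, Subtype.ext (add_assoc _ _ _).symm⟩
  exists_unique_compl A := by
    refine ⟨⟨1 - A.1, le_iff_sub_nonneg.1 A.2.2, ?_⟩, ⟨?_, ?_⟩, ?_⟩
    · rw [le_iff_sub_nonneg, sub_sub_cancel]; exact A.2.1
    · exact le_of_eq (add_sub_cancel _ _)
    · exact Subtype.ext (add_sub_cancel _ _)
    · rintro B ⟨_, hB⟩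
      exact Subtype.ext (eq_sub_of_add_eq' (congrArg Subtype.val hB))
  eq_zero_of_orth_one A h := by
    have h' : A.1 + 1 ≤ 1 := h
    refine Subtype.ext (le_antisymm ?_ A.2.1)
    rw [le_iff_sub_nonneg] at h' ⊢
    convert h' using 1
    change 0 - A.1 = _
    abel
  smul_smul' α β A := Subtype.ext (by
    change ((α : ℝ) : ℂ) • ((β : ℝ) : ℂ) • A.1 = (((α * β : unitInterval) : ℝ) : ℂ) • A.1
    rw [smul_smul]; push_cast; rfl)
  add_smul' α β γ A hγ := by
    have key : ((γ : ℝ) : ℂ) • A.1 = ((α : ℝ) : ℂ) • A.1 + ((β : ℝ) : ℂ) • A.1 := by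
      rw [hγ, ← add_smul]; push_cast; rfl
    refine ⟨?_, Subtype.ext key⟩
    change ((α : ℝ) : ℂ) • A.1 + ((β : ℝ) : ℂ) • A.1 ≤ 1
    rw [← key]
    exact smul_le_one' A.2.1 A.2.2 γ.2.2
  smul_osum c A B h := by
    have key : ((c : ℝ) : ℂ) • (A.1 + B.1) = ((c : ℝ) : ℂ) • A.1 + ((c : ℝ) : ℂ) • B.1 :=
      smul_add _ _ _
    refine ⟨?_, Subtype.ext key⟩
    change ((c : ℝ) : ℂ) • A.1 + ((c : ℝ) : ℂ) • B.1 ≤ 1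
    rw [← key]
    exact smul_le_one' (add_nonneg' A.2.1 B.2.1) h c.2.2
  one_smul' A := Subtype.ext (by
    change (((1 : unitInterval) : ℝ) : ℂ) • A.1 = A.1
    simp)

end HilbertEffect

/-- `E` is affinely isomorphic to a Hilbertian effect algebra `E(H)`, for some complex Hilbert
space `H` (of any dimension). -/
def IsHilbertian (E : Type u) [ConvexEffectAlgebra E] : Prop :=
  ∃ (H : Type v) (_ : NormedAddCommGroup H) (_ : InnerProductSpace ℂ H) (_ : CompleteSpace H)
    (_ : Nontrivial H), ConvexEffectAlgebra.AffinelyIsomorphic E (HilbertEffect H)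

/-! The bridge between both sides is a frame (`IsFrame`): orthonormal bases `ψ A` of one Hilbert
space `H`, one for each context, with `|⟨ψ A a, ψ C c⟩|² = â(c)`, whose members exhaust the unit
vectors up to phase. Completeness yields a frame, since the unitaries carry all contexts into one
fixed `H(B)`; conversely, a frame yields the unitaries as changes of basis.

Given a frame and spectrality, send `b = ⊕ λᵢ aᵢ` to `∑ λᵢ |ψ aᵢ⟩⟨ψ aᵢ|`. States are affine
(`state_smul`), so the diagonal value of this operator at `ψ C d` is the state of `d` evaluated at
`b`, whatever the decomposition (`IsFrame.inner_diagOp`). Since the frame vectors exhaust the rays,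
these values determine operators and their order, and the map is an affine morphism. The delicate
point is that it reflects orthogonality (`IsFrame.orth_of_map`): the half-sum `b/2 ⊕ d/2` always
exists, and its spectral coefficients turn out to be at most `1/2`, so it can be doubled.
Surjectivity then follows from the spectral theorem in `H`.

Conversely, under an affine isomorphism onto `E(H)`, one-dimensional sharp effects are the rank-one
projections and contexts are the orthonormal bases. So `H` is finite-dimensional, and spectrality is
the spectral theorem. The chosen states `â` are arbitrary, but `IsAffineIso.state_le` bounds `â(c)`
by `|⟨x, y⟩|²`, where `x` and `y` span the ranges of the projections of `a` and `c`. Both sides sum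
to `1` over a context, so equality holds for every choice. -/

namespace EffectAlgebra

/-! ### Partial sums, cancellation and finite orthogonal sums. -/

section Sums

variable {E : Type u} [EffectAlgebra E]

/-- `a ⊕ b` is defined and equals `c`. -/
def IsSum (a b c : E) : Prop := ∃ h : Orth a b, osum a b h = c

theorem IsSum.comm {a b c : E} (h : IsSum a b c) : IsSum b a c := by
  obtain ⟨h, rfl⟩ := h
  exact osum_comm a b h

theorem IsSum.assoc {a b c x y : E} (h : IsSum a b x) (h' : IsSum x c y) :
    ∃ z, IsSum b c z ∧ IsSum a z y := by
  obtain ⟨h, rfl⟩ := h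
  obtain ⟨h', rfl⟩ := h'
  obtain ⟨h₁, h₂, h₃⟩ := osum_assoc a b c h h'
  exact ⟨_, ⟨h₁, rfl⟩, h₂, h₃⟩

theorem IsSum.assoc_symm {a b c z y : E} (h : IsSum b c z) (h' : IsSum a z y) :
    ∃ x, IsSum a b x ∧ IsSum x c y := by
  obtain ⟨x, hx, hy⟩ := h.comm.assoc h'.comm
  exact ⟨x, hx.comm, hy.comm⟩

theorem IsSum.left_comm {a b c z y : E} (h : IsSum b c z) (h' : IsSum a z y) :
    ∃ x, IsSum a c x ∧ IsSum b x y := by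
  obtain ⟨x, hx, hy⟩ := h.assoc_symm h'
  exact hx.comm.assoc hy

theorem IsSum.eq {a b c d : E} (h : IsSum a b c) (h' : IsSum a b d) : c = d := by
  obtain ⟨_, rfl⟩ := h
  obtain ⟨_, rfl⟩ := h'
  rfl

theorem isSum_orthosupp (a : E) : IsSum a (orthosupp a) 1 :=
  (exists_unique_compl a).choose_spec.1

theorem IsSum.eq_orthosupp {a b : E} (h : IsSum a b 1) : b = orthosupp a :=
  (exists_unique_compl a).choose_spec.2 b h

theorem IsSum.right_cancel_one {a b c : E} (h : IsSum a b 1) (h' : IsSum a c 1) : b = c :=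
  h.eq_orthosupp.trans h'.eq_orthosupp.symm

/-- Adding `x'` makes `b` and `c` both orthosupplements of `a ⊕ x'`, and these are unique. -/
theorem IsSum.cancel {a b c x : E} (h : IsSum a b x) (h' : IsSum a c x) : b = c := by
  obtain ⟨y, hy, hy'⟩ := h.comm.assoc (isSum_orthosupp x)
  obtain ⟨z, hz, hz'⟩ := h'.comm.assoc (isSum_orthosupp x)
  obtain rfl := hy.eq hz
  exact hy'.comm.right_cancel_one hz'.comm

theorem isSum_zero (a : E) : IsSum a 0 a := by
  have h1 : IsSum (1 : E) 0 1 := by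
    have h := isSum_orthosupp (1 : E)
    rwa [eq_zero_of_orth_one _ h.comm.1] at h
  obtain ⟨z, hz, hz'⟩ := (isSum_orthosupp a).comm.assoc h1
  rwa [hz'.right_cancel_one (isSum_orthosupp a).comm] at hz

theorem isSum_self_iff {a b : E} : IsSum a b a ↔ b = 0 :=
  ⟨fun h => h.cancel (isSum_zero a), fun h => h ▸ isSum_zero a⟩

theorem IsSum.le {a b c : E} (h : IsSum a b c) : Le a c := ⟨b, h⟩

theorem Le.exists_isSum {a b : E} (h : Le a b) : ∃ c, IsSum a c b := h

theorem Le.trans {a b c : E} (h : Le a b) (h' : Le b c) : Le a c := by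
  obtain ⟨x, hx⟩ := h.exists_isSum
  obtain ⟨y, hy⟩ := h'.exists_isSum
  obtain ⟨z, -, hz⟩ := hx.assoc hy
  exact hz.le

/-- Summands of a defined sum may be replaced by smaller elements. -/
theorem IsSum.mono {a b c x y : E} (h : IsSum a b c) (hx : Le x a) (hy : Le y b) :
    ∃ z, IsSum x y z ∧ Le z c := by
  obtain ⟨p, hp⟩ := hx.exists_isSum
  obtain ⟨q, hq⟩ := hy.exists_isSum
  obtain ⟨r, hr, hr'⟩ := hq.assoc_symm h
  obtain ⟨s, hs, hs'⟩ := hp.comm.assoc hr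
  exact ⟨s, hs, hs'.comm.le.trans hr'.le⟩

/-- A derivation of `IsOrthoSum` adds the members in some order; associativity and commutativity let
any chosen member be added last. -/
theorem IsOrthoSum.exists_of_cons {a : E} {m : Multiset E} {s : E} (h : IsOrthoSum (a ::ₘ m) s) :
    ∃ t, IsOrthoSum m t ∧ IsSum a t s := by
  generalize hM : a ::ₘ m = M at h
  induction h generalizing m with
  | zero => exact absurd hM (Multiset.cons_ne_zero)
  | cons b m' t ht h ih =>
    rcases Multiset.cons_eq_cons.1 hM with ⟨rfl, rfl⟩ | ⟨-, cs, rfl, rfl⟩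
    · exact ⟨t, ht, h, rfl⟩
    · obtain ⟨r, hr, hr'⟩ := ih rfl
      obtain ⟨w, hw, hw'⟩ := hr'.left_comm ⟨h, rfl⟩
      obtain ⟨hbr, rfl⟩ := hw
      exact ⟨_, IsOrthoSum.cons b cs r hr hbr, hw'⟩

theorem IsOrthoSum.cons' {a : E} {m : Multiset E} {s t : E} (h : IsOrthoSum m t)
    (h' : IsSum a t s) : IsOrthoSum (a ::ₘ m) s := by
  obtain ⟨h', rfl⟩ := h'
  exact .cons a m t h h'

theorem IsOrthoSum.eq_zero {s : E} (h : IsOrthoSum 0 s) : s = 0 := by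
  generalize hM : (0 : Multiset E) = M at h
  cases h with
  | zero => rfl
  | cons a m s hs h => exact absurd hM.symm (Multiset.cons_ne_zero)

theorem IsOrthoSum.eq {m : Multiset E} {s t : E} (h : IsOrthoSum m s) (h' : IsOrthoSum m t) :
    s = t := by
  induction m using Multiset.induction generalizing s t with
  | empty => rw [h.eq_zero, h'.eq_zero]
  | cons a m ih =>
    obtain ⟨x, hx, hx'⟩ := h.exists_of_cons
    obtain ⟨y, hy, hy'⟩ := h'.exists_of_cons
    obtain rfl := ih hx hy
    exact hx'.eq hy'

theorem IsOrthoSum.mono {ι : Type*} {m : Multiset ι} {f g : ι → E} {s : E}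
    (h : IsOrthoSum (m.map f) s) (hfg : ∀ i ∈ m, Le (g i) (f i)) :
    ∃ t, IsOrthoSum (m.map g) t ∧ Le t s := by
  induction m using Multiset.induction generalizing s with
  | empty => exact ⟨0, by simpa using .zero, s, (isSum_zero s).comm⟩
  | cons a m ih =>
    rw [Multiset.map_cons] at h ⊢
    obtain ⟨x, hx, hx'⟩ := h.exists_of_cons
    obtain ⟨y, hy, hy'⟩ := ih hx fun i hi => hfg i (Multiset.mem_cons_of_mem hi)
    obtain ⟨z, hz, hz'⟩ := hx'.mono (hfg a (Multiset.mem_cons_self a m)) hy'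
    exact ⟨z, hy.cons' hz, hz'⟩

end Sums

/-! ### Morphisms and states. -/

section Morphisms

variable {E : Type u} {F : Type v} [EffectAlgebra E] [EffectAlgebra F] {φ : E → F}

theorem IsMorphism.map_isSum (hφ : IsMorphism φ) {a b c : E} (h : IsSum a b c) :
    IsSum (φ a) (φ b) (φ c) := by
  obtain ⟨h, rfl⟩ := h
  obtain ⟨h', e⟩ := hφ.map_osum a b h
  exact ⟨h', e.symm⟩

theorem IsMorphism.map_zero (hφ : IsMorphism φ) : φ 0 = 0 :=
  isSum_self_iff.1 (hφ.map_isSum (isSum_zero (0 : E)))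

/-- A morphism that reflects orthogonality is injective. -/
theorem IsMorphism.injective (hφ : IsMorphism φ) (h : ∀ a b, Orth (φ a) (φ b) → Orth a b) :
    Function.Injective φ := by
  intro a b hab
  have hb := hφ.map_isSum (isSum_orthosupp b)
  rw [← hab] at hb
  -- The sum `x = a ⊕ b'` has the image of `1`, so `φ x' = 0`. Reflecting `φ x' ⊥ φ 1` gives `x' ⊥
  -- 1`, hence `x' = 0` and `x = 1`.
  have hs : IsSum a (orthosupp b) (osum a _ (h _ _ hb.1)) := ⟨_, rfl⟩
  set x := osum a _ (h _ _ hb.1)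
  have hx : φ x = φ 1 := (hφ.map_isSum hs).eq hb
  have hx' := hφ.map_isSum (isSum_orthosupp x)
  rw [hx, isSum_self_iff] at hx'
  have h0 : orthosupp x = 0 := by
    refine eq_zero_of_orth_one _ (h _ _ ?_)
    rw [hx']
    exact (isSum_zero _).comm.1
  have h1 : x = 1 := by
    have := isSum_orthosupp x
    rw [h0] at this
    exact (isSum_zero x).eq this
  rw [h1] at hs
  exact hs.comm.right_cancel_one (isSum_orthosupp b).comm

theorem State.add {ω : State E} {a b c : E} (h : IsSum a b c) :
    (ω.1 c : ℝ) = ω.1 a + ω.1 b := by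
  obtain ⟨_, h⟩ := ω.2.map_isSum h
  rw [← h]
  rfl

theorem State.mono {ω : State E} {a b : E} (h : Le a b) : (ω.1 a : ℝ) ≤ ω.1 b := by
  obtain ⟨c, h⟩ := h.exists_isSum
  rw [State.add h]
  linarith [(ω.1 c).2.1]

theorem State.sum {ω : State E} {m : Multiset E} {s : E} (h : IsOrthoSum m s) :
    (ω.1 s : ℝ) = (m.map fun a => (ω.1 a : ℝ)).sum := by
  induction h with
  | zero => rw [ω.2.map_zero]; simp
  | cons a m s hs h ih => rw [Multiset.map_cons, Multiset.sum_cons, ← ih, State.add ⟨h, rfl⟩]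

end Morphisms

end EffectAlgebra

/-! ### Scalar multiples, halves, and affinity of states. -/

namespace ConvexEffectAlgebra

open EffectAlgebra

variable {E : Type u} [ConvexEffectAlgebra E]

theorem isSum_smul_add {α β γ : unitInterval} (a : E) (h : (γ : ℝ) = α + β) :
    IsSum (α • a) (β • a) (γ • a) := by
  obtain ⟨h, e⟩ := add_smul' α β γ a h
  exact ⟨h, e.symm⟩

theorem isSum_smul (c : unitInterval) {a b s : E} (h : IsSum a b s) :
    IsSum (c • a) (c • b) (c • s) := by
  obtain ⟨h, rfl⟩ := h
  obtain ⟨h', e⟩ := smul_osum c a b h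
  exact ⟨h', e.symm⟩

theorem zero_smul' (a : E) : (0 : unitInterval) • a = 0 :=
  isSum_self_iff.1 (isSum_smul_add (α := 0) (γ := 0) a (by simp))

theorem smul_zero' (c : unitInterval) : c • (0 : E) = 0 :=
  isSum_self_iff.1 (isSum_smul c (isSum_zero 0))

theorem smul_le_smul {c d : unitInterval} (h : c ≤ d) (a : E) : Le (c • a) (d • a) :=
  (isSum_smul_add (β := ⟨d - c, sub_nonneg.2 h, by linarith [d.2.2, c.2.1]⟩) a
    (by simp)).le

theorem smul_le (c : unitInterval) (a : E) : Le (c • a) a := by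
  simpa [one_smul'] using smul_le_smul (d := 1) c.2.2 a

theorem isOrthoSum_smul {m : Multiset E} {s : E} (h : IsOrthoSum m s) (c : unitInterval) :
    IsOrthoSum (m.map (c • ·)) (c • s) := by
  induction h with
  | zero => rw [smul_zero']; exact .zero
  | cons a m s hs h ih =>
    rw [Multiset.map_cons]
    exact ih.cons' (isSum_smul c ⟨h, rfl⟩)

/-- The number `1 / 2` in the unit interval. -/
noncomputable def half : unitInterval := ⟨1 / 2, by norm_num, by norm_num⟩

theorem coe_half : (half : ℝ) = 1 / 2 := rfl

theorem isSum_half (a : E) : IsSum (half • a) (half • a) a := by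
  simpa [one_smul'] using isSum_smul_add (α := half) (β := half) (γ := 1) a (by norm_num [coe_half])

/-- Both halves lie below `half • 1`, which is orthogonal to itself. -/
theorem exists_isSum_half (a b : E) : ∃ c, IsSum (half • a) (half • b) c := by
  obtain ⟨z, hz, -⟩ := (isSum_half (1 : E)).mono (isSum_smul half (isSum_orthosupp a)).le
    (isSum_smul half (isSum_orthosupp b)).le
  exact ⟨z, hz⟩

/-- Add the hypothesis to itself and regroup the four halves. -/
theorem isSum_of_half {a b f : E} (h : IsSum (half • a) (half • b) (half • f)) : IsSum a b f := by
  obtain ⟨x, hx, hx'⟩ := h.assoc (isSum_half f)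
  obtain ⟨y, hy, hy'⟩ := h.left_comm hx
  obtain ⟨z, hz, hz'⟩ := hy'.assoc_symm hx'
  rw [← (isSum_half a).eq hz, ← (isSum_half b).eq hy] at hz'
  exact hz'

theorem state_nsmul (ω : State E) (a : E) (n : ℕ) (s t : unitInterval) (h : (s : ℝ) = n * t) :
    (ω.1 (s • a) : ℝ) = n * ω.1 (t • a) := by
  induction n generalizing s with
  | zero =>
    obtain rfl : s = 0 := Subtype.ext (by simpa using h)
    rw [zero_smul', ω.2.map_zero]
    simp
  | succ n ih =>
    push_cast at h
    have ht := t.2.1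
    have hr : (n : ℝ) * t ∈ unitInterval :=
      ⟨by positivity, by linarith [s.2.2]⟩
    rw [State.add (isSum_smul_add (α := ⟨_, hr⟩) (β := t) a (by simp [h]; ring)), ih ⟨_, hr⟩ rfl]
    push_cast
    ring

/-- Every state is affine. -/
theorem state_smul (ω : State E) (c : unitInterval) (a : E) :
    (ω.1 (c • a) : ℝ) = c * ω.1 a := by
  -- Compare `c` with the multiple `k / (n + 1)` just below it, where additivity fixes the value of
  -- `ω`.
  have lower : ∀ (c : unitInterval) (n : ℕ), (c - 1 / (n + 1) : ℝ) * ω.1 a ≤ ω.1 (c • a) := by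
    intro c n
    have hn : (0 : ℝ) < n + 1 := by positivity
    have ht : 1 / ((n : ℝ) + 1) ∈ unitInterval :=
      ⟨by positivity, by rw [div_le_one hn]; linarith [n.cast_nonneg (α := ℝ)]⟩
    have hc : 0 ≤ (c : ℝ) * (n + 1) := mul_nonneg c.2.1 hn.le
    have hk := Nat.floor_le hc
    have hk' := Nat.lt_floor_add_one ((c : ℝ) * (n + 1))
    set k := ⌊(c : ℝ) * (n + 1)⌋₊
    have hkc : (k : ℝ) * (1 / (n + 1)) ≤ c := by
      rw [mul_one_div, div_le_iff₀ hn]; exact hk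
    have h1 := state_nsmul ω a (n + 1) 1 ⟨_, ht⟩ (by push_cast; field_simp)
    have h2 := state_nsmul ω a k ⟨_, by positivity, hkc.trans c.2.2⟩ ⟨_, ht⟩ rfl
    have h3 := State.mono (ω := ω) (smul_le_smul (E := E)
      (c := ⟨(k : ℝ) * (1 / (n + 1)), by positivity, hkc.trans c.2.2⟩) (d := c) hkc a)
    rw [h2] at h3
    rw [one_smul'] at h1
    refine le_trans ?_ h3
    rw [h1]
    push_cast
    rw [← mul_assoc]
    refine mul_le_mul_of_nonneg_right ?_ (ω.1 _).2.1
    rw [sub_mul, one_div, inv_mul_cancel₀ hn.ne']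
    linarith
  have limit : ∀ c : unitInterval, (c : ℝ) * ω.1 a ≤ ω.1 (c • a) := by
    intro c
    refine le_of_tendsto' (x := Filter.atTop) ?_ (lower c)
    have := (tendsto_one_div_add_atTop_nhds_zero_nat (𝕜 := ℝ)).const_sub (c : ℝ)
    simpa using this.mul_const (ω.1 a : ℝ)
  -- The upper bound is the lower bound for `1 - c`.
  have hs := State.add (ω := ω)
    (isSum_smul_add (α := c) (β := unitInterval.symm c) (γ := 1) a (by simp))
  rw [one_smul'] at hs
  have := limit (unitInterval.symm c)
  rw [unitInterval.coe_symm_eq] at this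
  exact le_antisymm (by linarith) (limit c)

end ConvexEffectAlgebra

section

open InnerProductSpace
open scoped ComplexOrder

/-! ### The order on operators, rank-one projections, and the spectral theorem for effects. -/

section Operators

variable {H : Type*} [NormedAddCommGroup H] [InnerProductSpace ℂ H]

theorem inner_rankOne_self (x v : H) :
    inner ℂ (rankOne ℂ x x v) v = ((‖inner ℂ x v‖ ^ 2 : ℝ) : ℂ) := by
  rw [inner_left_rankOne_apply, ← inner_conj_symm, RCLike.conj_mul]
  norm_cast

/-- Over `ℂ`, real diagonal values already force symmetry. -/
theorem ContinuousLinearMap.nonneg_iff_forall {T : H →L[ℂ] H} :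
    0 ≤ T ↔ ∀ v, 0 ≤ inner ℂ (T v) v := by
  rw [ContinuousLinearMap.nonneg_iff_isPositive]
  refine ⟨fun h v => h.inner_nonneg_left v, fun h => ?_⟩
  rw [ContinuousLinearMap.isPositive_iff_complex]
  intro v
  obtain ⟨h1, h2⟩ := Complex.le_def.1 (h v)
  exact ⟨Complex.ext rfl (by simpa using h2), h1⟩

theorem ContinuousLinearMap.le_iff_forall {S T : H →L[ℂ] H} :
    S ≤ T ↔ ∀ v, inner ℂ (S v) v ≤ inner ℂ (T v) v := by
  rw [HilbertEffect.le_iff_sub_nonneg, ContinuousLinearMap.nonneg_iff_forall]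
  simp

theorem ContinuousLinearMap.ext_inner_self {S T : H →L[ℂ] H}
    (h : ∀ v, inner ℂ (S v) v = inner ℂ (T v) v) : S = T :=
  ContinuousLinearMap.coe_injective ((ext_inner_map S.toLinearMap T.toLinearMap).1 h)

theorem rankOne_self_nonneg (x : H) : 0 ≤ rankOne ℂ x x := by
  rw [ContinuousLinearMap.nonneg_iff_isPositive]
  exact isPositive_rankOne_self x

theorem rankOne_self_le_one {x : H} (hx : ‖x‖ ≤ 1) : rankOne ℂ x x ≤ 1 := by
  rw [ContinuousLinearMap.le_iff_forall]
  intro v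
  rw [inner_rankOne_self, one_apply_eq_self, inner_self_eq_norm_sq_to_K]
  have h : ‖inner ℂ x v‖ ≤ ‖v‖ := (norm_inner_le_norm x v).trans
    (mul_le_of_le_one_left (norm_nonneg v) hx)
  have h' : ‖inner ℂ x v‖ ^ 2 ≤ ‖v‖ ^ 2 := by gcongr
  exact (Complex.real_le_real.2 h').trans_eq (by simp)

theorem rankOne_smul_self (z : ℂ) (x : H) :
    rankOne ℂ (z • x) (z • x) = ((‖z‖ ^ 2 : ℝ) : ℂ) • rankOne ℂ x x := by
  refine ContinuousLinearMap.ext_inner_self fun v => ?_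
  rw [_root_.smul_apply, inner_smul_left, inner_rankOne_self, inner_rankOne_self,
    inner_smul_left]
  simp [mul_pow]

theorem OrthonormalBasis.sum_rankOne {ι : Type*} [Fintype ι] (e : OrthonormalBasis ι ℂ H) :
    ∑ i, rankOne ℂ (e i) (e i) = 1 := by
  ext v
  simpa using e.sum_repr' v

/-- Spectral theorem for effects on a finite-dimensional Hilbert space. -/
theorem exists_eq_sum_smul_rankOne [FiniteDimensional ℂ H] {S : H →L[ℂ] H} (h0 : 0 ≤ S)
    (h1 : S ≤ 1) :
    ∃ (e : OrthonormalBasis (Fin (Module.finrank ℂ H)) ℂ H)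
      (c : Fin (Module.finrank ℂ H) → unitInterval),
      S = ∑ i, ((c i : ℝ) : ℂ) • rankOne ℂ (e i) (e i) := by
  have hs : S.toLinearMap.IsSymmetric :=
    ((ContinuousLinearMap.nonneg_iff_isPositive S).1 h0).isSymmetric
  set e := hs.eigenvectorBasis rfl
  set l := hs.eigenvalues rfl
  have he : ∀ i, S (e i) = (l i : ℂ) • e i := hs.apply_eigenvectorBasis rfl
  have hl : ∀ i, inner ℂ (S (e i)) (e i) = (l i : ℂ) := by
    intro i
    rw [he, inner_smul_left, inner_self_eq_norm_sq_to_K, e.norm_eq_one]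
    simp
  have hmem : ∀ i, l i ∈ unitInterval := by
    intro i
    constructor
    · have := ContinuousLinearMap.nonneg_iff_forall.1 h0 (e i)
      rw [hl] at this
      exact_mod_cast this
    · have := ContinuousLinearMap.le_iff_forall.1 h1 (e i)
      rw [hl, one_apply_eq_self, inner_self_eq_norm_sq_to_K, e.norm_eq_one] at this
      simpa [Complex.le_def] using this
  refine ⟨e, fun i => ⟨l i, hmem i⟩, ?_⟩
  ext v
  conv_lhs => rw [← e.sum_repr' v, map_sum]
  simp only [map_smul, he, _root_.sum_apply, _root_.smul_apply, rankOne_apply]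
  exact Finset.sum_congr rfl fun i _ => smul_comm _ _ _

end Operators

/-! ### Orthogonal sums and their images in `E(H)`. -/

namespace HilbertEffect

open EffectAlgebra

variable {H : Type v} [NormedAddCommGroup H] [InnerProductSpace ℂ H]

theorem coe_smul (c : unitInterval) (A : HilbertEffect H) : (c • A).1 = ((c : ℝ) : ℂ) • A.1 := rfl

variable [Nontrivial H]

theorem isSum_iff {A B C : HilbertEffect H} : IsSum A B C ↔ A.1 + B.1 = C.1 := by
  constructor
  · rintro ⟨h, rfl⟩
    rfl
  · intro h
    exact ⟨h.trans_le C.2.2, Subtype.ext h⟩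

theorem coe_one : (1 : HilbertEffect H).1 = 1 := rfl

theorem coe_zero : (0 : HilbertEffect H).1 = 0 := rfl

variable {E : Type u} [EffectAlgebra E] {φ : E → HilbertEffect H}

theorem map_isOrthoSum (hφ : IsMorphism φ) {m : Multiset E} {s : E} (h : IsOrthoSum m s) :
    (φ s).1 = (m.map fun a => (φ a).1).sum := by
  induction h with
  | zero => rw [hφ.map_zero]; rfl
  | cons a m s hs h ih =>
    rw [Multiset.map_cons, Multiset.sum_cons, ← ih]
    exact (isSum_iff.1 (hφ.map_isSum ⟨h, rfl⟩)).symm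

/-- If `φ` reflects orthogonality, a family has an orthogonal sum as soon as the sum of its image
is an effect. -/
theorem exists_isOrthoSum (hφ : IsMorphism φ) (ho : ∀ a b, Orth (φ a) (φ b) → Orth a b)
    {m : Multiset E} (h : (m.map fun a => (φ a).1).sum ≤ 1) :
    ∃ s, IsOrthoSum m s ∧ (φ s).1 = (m.map fun a => (φ a).1).sum := by
  suffices ∃ s, IsOrthoSum m s from this.imp fun s hs => ⟨hs, map_isOrthoSum hφ hs⟩
  induction m using Multiset.induction with
  | empty => exact ⟨0, .zero⟩
  | cons a m ih =>
    rw [Multiset.map_cons, Multiset.sum_cons] at h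
    have hm : (m.map fun a => (φ a).1).sum ≤ 1 := by
      rw [le_iff_sub_nonneg] at h ⊢
      convert add_nonneg' h (φ a).2.1 using 1
      abel
    obtain ⟨s, hs⟩ := ih hm
    rw [← map_isOrthoSum hφ hs] at h
    exact ⟨_, .cons a m s hs (ho _ _ h)⟩

end HilbertEffect

namespace ConvexEffectAlgebra

open EffectAlgebra

/-! ### From a frame and spectrality to an affine isomorphism onto `E(H)`. -/

section Frames

variable {E : Type u} [ConvexEffectAlgebra E] {H : Type v} [NormedAddCommGroup H]
  [InnerProductSpace ℂ H]

/-- Orthonormal bases of a single Hilbert space, one for each context, that represent the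
transition probabilities between contexts and exhaust the rays of the space. -/
structure IsFrame (κ : HatChoice E) (ψ : ∀ A : Context E, OrthonormalBasis A.carrier ℂ H) :
    Prop where
  transition : ∀ (A C : Context E) (a : A.carrier) (c : C.carrier),
    ‖inner ℂ (ψ A a) (ψ C c)‖ ^ 2 = ((κ.hat a (A.isOneDimSharp a a.2)).1 c : ℝ)
  exhaust : ∀ x : H, ‖x‖ = 1 → ∃ (A : Context E) (a : A.carrier) (z : ℂ),
    ‖z‖ = 1 ∧ ψ A a = z • x

/-- The operator `∑ cₐ |ψₐ⟩⟨ψₐ|` attached to a context. -/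
noncomputable def diagOp (ψ : ∀ A : Context E, OrthonormalBasis A.carrier ℂ H) (A : Context E)
    (c : E → unitInterval) : H →L[ℂ] H :=
  ∑ a : A.carrier, ((c a : ℝ) : ℂ) • rankOne ℂ (ψ A a) (ψ A a)

/-- The operator attached to an effect by a spectral decomposition of it. -/
noncomputable def effectOp (hS : IsSpectral E)
    (ψ : ∀ A : Context E, OrthonormalBasis A.carrier ℂ H) (b : E) : H →L[ℂ] H :=
  diagOp ψ (hS b).choose (hS b).choose_spec.choose

/-- The state `â`, for `a` in the context `A`. -/
noncomputable abbrev Context.hat (κ : HatChoice E) (A : Context E) (a : A.carrier) : State E :=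
  κ.hat a (A.isOneDimSharp a a.2)

theorem Context.state_eq_sum (ω : State E) {A : Context E} {c : E → unitInterval} {b : E}
    (h : IsOrthoSum (A.carrier.val.map fun a => c a • a) b) :
    (ω.1 b : ℝ) = ∑ a : A.carrier, (c a : ℝ) * ω.1 a := by
  rw [State.sum h, Multiset.map_map, Finset.sum_coe_sort A.carrier fun a => (c a : ℝ) * ω.1 a]
  exact Finset.sum_congr rfl fun a _ => state_smul ω (c a) a

theorem Context.isOrthoSum_one (A : Context E) :
    IsOrthoSum (A.carrier.val.map fun a => (1 : unitInterval) • a) 1 := by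
  simpa [one_smul'] using A.sum_eq_one

variable {κ : HatChoice E} {ψ : ∀ A : Context E, OrthonormalBasis A.carrier ℂ H}

/-- By orthonormality of `ψ A`, the state `â` vanishes on the other members of `A`, so it reads off
the coefficient at `a`. -/
theorem IsFrame.hat_eq_coeff (hψ : IsFrame κ ψ) {A : Context E} {c : E → unitInterval} {b : E}
    (h : IsOrthoSum (A.carrier.val.map fun a => c a • a) b) (a : A.carrier) :
    (A.hat κ a).1 b = c a := by
  classical
  ext
  rw [Context.state_eq_sum _ h, Finset.sum_eq_single a]
  · rw [← hψ.transition A A a a]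
    simp
  · intro d _ hd
    rw [← hψ.transition A A a d, (ψ A).inner_eq_ite, if_neg hd.symm]
    simp
  · simp

/-- The right-hand side does not mention the decomposition of `b`; this makes the operator of an
effect well defined and additive. -/
theorem IsFrame.inner_diagOp (hψ : IsFrame κ ψ) {A : Context E} {c : E → unitInterval} {b : E}
    (h : IsOrthoSum (A.carrier.val.map fun a => c a • a) b) (C : Context E) (d : C.carrier) :
    inner ℂ (diagOp ψ A c (ψ C d)) (ψ C d) = (((C.hat κ d).1 b : ℝ) : ℂ) := by
  rw [Context.state_eq_sum _ h, diagOp, _root_.sum_apply, sum_inner,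
    Complex.ofReal_sum]
  refine Finset.sum_congr rfl fun a _ => ?_
  rw [_root_.smul_apply, inner_smul_left, inner_rankOne_self, norm_inner_symm,
    hψ.transition C A d a]
  simp

theorem IsFrame.inner_effectOp (hψ : IsFrame κ ψ) (hS : IsSpectral E) (b : E) (C : Context E)
    (d : C.carrier) :
    inner ℂ (effectOp hS ψ b (ψ C d)) (ψ C d) = (((C.hat κ d).1 b : ℝ) : ℂ) :=
  hψ.inner_diagOp (hS b).choose_spec.choose_spec C d

/-- Normalising `x` gives a frame vector up to phase, and the phase cancels in a quadratic form; `r`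
is `‖x‖ ^ 2`. Operators can thus be compared on frame vectors alone. -/
theorem IsFrame.exists_inner_eq (hψ : IsFrame κ ψ) {x : H} (hx : x ≠ 0) :
    ∃ (C : Context E) (d : C.carrier) (r : ℝ), 0 ≤ r ∧
      ∀ T : H →L[ℂ] H, inner ℂ (T x) x = r * inner ℂ (T (ψ C d)) (ψ C d) := by
  obtain ⟨C, d, z, hz, h⟩ := hψ.exhaust ((‖x‖⁻¹ : ℂ) • x) (by simp [norm_smul, hx])
  refine ⟨C, d, ‖x‖ ^ 2, by positivity, fun T => ?_⟩
  have hz' : (starRingEnd ℂ z) * z = 1 := by rw [RCLike.conj_mul, hz]; simp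
  have hx' : (‖x‖ : ℂ) ≠ 0 := by simpa using hx
  rw [h, smul_smul, map_smul, inner_smul_left, inner_smul_right, map_mul]
  simp only [map_inv₀, Complex.conj_ofReal]
  push_cast
  field_simp
  linear_combination (- inner ℂ (T x) x) * hz'

theorem IsFrame.op_ext (hψ : IsFrame κ ψ) {S T : H →L[ℂ] H}
    (h : ∀ (C : Context E) (d : C.carrier),
      inner ℂ (S (ψ C d)) (ψ C d) = inner ℂ (T (ψ C d)) (ψ C d)) : S = T := by
  refine ContinuousLinearMap.ext_inner_self fun x => ?_
  rcases eq_or_ne x 0 with rfl | hx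
  · simp
  · obtain ⟨C, d, r, -, hr⟩ := hψ.exists_inner_eq hx
    rw [hr, hr, h]

theorem IsFrame.op_le (hψ : IsFrame κ ψ) {S T : H →L[ℂ] H}
    (h : ∀ (C : Context E) (d : C.carrier),
      inner ℂ (S (ψ C d)) (ψ C d) ≤ inner ℂ (T (ψ C d)) (ψ C d)) : S ≤ T := by
  rw [ContinuousLinearMap.le_iff_forall]
  intro x
  rcases eq_or_ne x 0 with rfl | hx
  · simp
  · obtain ⟨C, d, r, hr0, hr⟩ := hψ.exists_inner_eq hx
    rw [hr, hr]
    exact mul_le_mul_of_nonneg_left (h C d) (by exact_mod_cast hr0)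

theorem IsFrame.inner_one (ψ : ∀ A : Context E, OrthonormalBasis A.carrier ℂ H) (C : Context E)
    (d : C.carrier) : inner ℂ ((1 : H →L[ℂ] H) (ψ C d)) (ψ C d) = 1 := by
  simp

theorem IsFrame.effectOp_nonneg (hψ : IsFrame κ ψ) (hS : IsSpectral E) (b : E) :
    0 ≤ effectOp hS ψ b :=
  hψ.op_le fun C d => by
    rw [hψ.inner_effectOp]
    simpa using ((C.hat κ d).1 b).2.1

theorem IsFrame.effectOp_le_one (hψ : IsFrame κ ψ) (hS : IsSpectral E) (b : E) :
    effectOp hS ψ b ≤ 1 :=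
  hψ.op_le fun C d => by
    rw [hψ.inner_effectOp, IsFrame.inner_one]
    exact_mod_cast ((C.hat κ d).1 b).2.2

theorem IsFrame.effectOp_mem (hψ : IsFrame κ ψ) (hS : IsSpectral E) {A : Context E}
    (a : A.carrier) : effectOp hS ψ (a : E) = rankOne ℂ (ψ A a) (ψ A a) :=
  hψ.op_ext fun C d => by
    rw [hψ.inner_effectOp, inner_rankOne_self, norm_inner_symm, hψ.transition]

theorem IsFrame.effectOp_smul (hψ : IsFrame κ ψ) (hS : IsSpectral E) (c : unitInterval) (b : E) :
    effectOp hS ψ (c • b) = ((c : ℝ) : ℂ) • effectOp hS ψ b :=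
  hψ.op_ext fun C d => by
    rw [_root_.smul_apply, inner_smul_left, hψ.inner_effectOp, hψ.inner_effectOp, state_smul]
    simp

/-- The effect of `E(H)` attached to an effect of `E`. -/
noncomputable def IsFrame.toHilbertEffect (hψ : IsFrame κ ψ) (hS : IsSpectral E) (b : E) :
    HilbertEffect H :=
  ⟨effectOp hS ψ b, hψ.effectOp_nonneg hS b, hψ.effectOp_le_one hS b⟩

variable [Nontrivial H]

theorem IsFrame.isMorphism (hψ : IsFrame κ ψ) (hS : IsSpectral E) :
    IsMorphism (hψ.toHilbertEffect hS) where
  map_osum a b h := by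
    have : IsSum (hψ.toHilbertEffect hS a) (hψ.toHilbertEffect hS b)
        (hψ.toHilbertEffect hS (osum a b h)) := by
      refine HilbertEffect.isSum_iff.2 (hψ.op_ext fun C d => ?_)
      change inner ℂ ((effectOp hS ψ a + effectOp hS ψ b) _) _ = inner ℂ (effectOp hS ψ _ _) _
      rw [_root_.add_apply, inner_add_left, hψ.inner_effectOp, hψ.inner_effectOp,
        hψ.inner_effectOp, State.add (c := osum a b h) ⟨h, rfl⟩]
      push_cast
      rfl
    exact this.imp fun _ => Eq.symm
  map_one := by
    refine Subtype.ext (hψ.op_ext fun C d => ?_)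
    rw [HilbertEffect.coe_one, IsFrame.inner_one]
    change inner ℂ (effectOp hS ψ _ _) _ = _
    rw [hψ.inner_effectOp, (C.hat κ d).2.map_one]
    simp

/-- Decompose `e = b/2 ⊕ d/2` spectrally. If all coefficients are at most `1/2`, doubling them gives
an effect `f` with `e = f/2`, and then `b ⊕ d = f`. -/
theorem IsFrame.orth_of_map (hψ : IsFrame κ ψ) (hS : IsSpectral E) {b d : E}
    (h : Orth (hψ.toHilbertEffect hS b) (hψ.toHilbertEffect hS d)) : Orth b d := by
  obtain ⟨e, he⟩ := exists_isSum_half b d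
  obtain ⟨A, c, hc⟩ := hS e
  -- The coefficient is `â(e)`, half of `â(b) + â(d)`, and that sum is a diagonal value of an
  -- operator below `1`.
  have hhalf : ∀ a : A.carrier, (c a : ℝ) ≤ 1 / 2 := by
    intro a
    have h1 : (c a : ℝ) = 1 / 2 * (A.hat κ a).1 b + 1 / 2 * (A.hat κ a).1 d := by
      rw [← hψ.hat_eq_coeff hc a, State.add he, state_smul, state_smul, coe_half]
    have h2 := ContinuousLinearMap.le_iff_forall.1 h (ψ A a)
    rw [IsFrame.inner_one, _root_.add_apply, inner_add_left] at h2
    change inner ℂ (effectOp hS ψ _ _) _ + inner ℂ (effectOp hS ψ _ _) _ ≤ _ at h2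
    rw [hψ.inner_effectOp, hψ.inner_effectOp] at h2
    norm_cast at h2
    rw [h1]
    linarith
  classical
  -- The default `0` never occurs on `A`, by `hhalf`.
  let c' : E → unitInterval := fun a =>
    if h : (c a : ℝ) ≤ 1 / 2 then ⟨2 * c a, by linarith [(c a).2.1], by linarith⟩ else 0
  obtain ⟨f, hf, -⟩ := IsOrthoSum.mono (f := id) (g := fun a => c' a • a) (m := A.carrier.val)
    (by simpa using A.sum_eq_one) fun a _ => smul_le (c' a) a
  have hf' := isOrthoSum_smul hf half
  rw [Multiset.map_map] at hf'
  have hef : e = half • f := by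
    refine hc.eq ?_
    convert hf' using 1
    refine Multiset.map_congr rfl fun a ha => ?_
    rw [Function.comp_apply, smul_smul']
    congr 1
    ext
    have := hhalf ⟨a, ha⟩
    simp only [c', this, dite_true, Set.Icc.coe_mul, coe_half]
    ring
  rw [hef] at he
  exact (isSum_of_half he).1

theorem IsFrame.isAffineIso [FiniteDimensional ℂ H] (hψ : IsFrame κ ψ) (hS : IsSpectral E) :
    IsAffineIso (hψ.toHilbertEffect hS) where
  toIsMorphism := hψ.isMorphism hS
  orth_of_map _ _ h := hψ.orth_of_map hS h
  map_smul c a := Subtype.ext (hψ.effectOp_smul hS c a)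
  surjective S := by
    obtain ⟨e, c, hS'⟩ := exists_eq_sum_smul_rankOne S.2.1 S.2.2
    -- The eigenvectors may come from different contexts; their weighted effects are still summable
    -- in `E` because orthogonality is reflected.
    choose A a z hz h using fun i => hψ.exhaust (e i) (e.norm_eq_one i)
    have ha : ∀ i, (hψ.toHilbertEffect hS (c i • (a i : E))).1 =
        ((c i : ℝ) : ℂ) • rankOne ℂ (e i) (e i) := by
      intro i
      change effectOp hS ψ _ = _
      rw [hψ.effectOp_smul, hψ.effectOp_mem, h, rankOne_smul_self, hz]
      simp
    have hsum : ((Finset.univ.val.map fun i => c i • (a i : E)).map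
        fun b => (hψ.toHilbertEffect hS b).1).sum = S.1 := by
      rw [Multiset.map_map, hS']
      exact Finset.sum_congr rfl fun i _ => ha i
    obtain ⟨s, -, hs⟩ := HilbertEffect.exists_isOrthoSum (hψ.isMorphism hS)
      (fun _ _ h => hψ.orth_of_map hS h) (hsum.trans_le S.2.2)
    exact ⟨s, Subtype.ext (hs.trans hsum)⟩

end Frames

variable {E : Type u} [ConvexEffectAlgebra E]

theorem Context.nonempty (A : Context E) : Nonempty A.carrier := by
  rw [Finset.nonempty_coe_sort, Finset.nonempty_iff_ne_empty]
  intro h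
  have := A.sum_eq_one
  rw [h] at this
  exact EffectAlgebra.zero_ne_one this.eq_zero.symm

theorem Context.vec_eq (A : Context E) (a : A.carrier) :
    A.vec a = EuclideanSpace.basisFun A.carrier ℂ a := by
  classical
  rw [Context.vec, EuclideanSpace.basisFun_apply]

theorem isHilbertian_of_isComplete (hE : IsFiniteDimensional E) {κ : HatChoice E}
    (hκ : IsComplete κ) (hS : IsSpectral E) : IsHilbertian.{u, v} E := by
  obtain ⟨B⟩ := hE
  obtain ⟨U, hU, hU'⟩ := hκ
  have := B.nonempty
  let n := Fintype.card B.carrier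
  -- The state space of `B` lives in universe `u`; this copy of it lives in `v`.
  let W : B.stateSpace ≃ₗᵢ[ℂ] EuclideanSpace ℂ (ULift.{v} (Fin n)) :=
    LinearIsometryEquiv.piLpCongrLeft 2 ℂ ℂ ((Fintype.equivFin B.carrier).trans Equiv.ulift.symm)
  have : Nonempty (ULift.{v} (Fin n)) :=
    ⟨⟨Fintype.equivFin B.carrier (Classical.arbitrary _)⟩⟩
  let ψ : ∀ A : Context E, OrthonormalBasis A.carrier ℂ (EuclideanSpace ℂ (ULift.{v} (Fin n))) :=
    fun A => (EuclideanSpace.basisFun A.carrier ℂ).map ((U A B).trans W)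
  have hψe : ∀ A a, ψ A a = W (U A B (A.vec a)) := by
    intro A a
    rw [Context.vec_eq]
    rfl
  have hψ : IsFrame κ ψ := by
    constructor
    · intro A C a c
      rw [hψe, hψe, LinearIsometryEquiv.inner_map_map]
      exact hU.transition A B C a c
    · intro x hx
      obtain ⟨A, a, z, hz, h⟩ := hU' B (W.symm x) (by simpa using hx)
      exact ⟨A, a, z, hz, by rw [hψe, h, map_smul, W.apply_symm_apply]⟩
  exact ⟨_, _, _, inferInstance, inferInstance, _, hψ.isAffineIso hS⟩

end ConvexEffectAlgebra

/-! ### Cauchy–Schwarz for positive operators, and rank-one inequalities. -/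

section Operators

variable {H : Type*} [NormedAddCommGroup H] [InnerProductSpace ℂ H]

/-- The Cauchy–Schwarz inequality for the form `⟨A x, y⟩` of a positive operator `A`. -/
theorem norm_inner_sq_le_of_nonneg {A : H →L[ℂ] H} (hA : 0 ≤ A) (x y : H) :
    ‖inner ℂ (A x) y‖ ^ 2 ≤ (inner ℂ (A x) x).re * (inner ℂ (A y) y).re := by
  rw [ContinuousLinearMap.nonneg_iff_isPositive] at hA
  let core : PreInnerProductSpace.Core ℂ H :=
    { inner := fun x y => inner ℂ (A x) y
      conj_inner_symm := fun x y => by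
        rw [inner_conj_symm, hA.inner_left_eq_inner_right]
      re_inner_nonneg := fun x => hA.re_inner_nonneg_left x
      add_left := fun x y z => by rw [map_add, inner_add_left]
      smul_left := fun x y r => by rw [map_smul, inner_smul_left] }
  have h := @InnerProductSpace.Core.inner_mul_inner_self_le ℂ H _ _ _ core x y
  change ‖inner ℂ (A x) y‖ * ‖inner ℂ (A y) x‖ ≤ _ at h
  rw [hA.inner_left_eq_inner_right y x, norm_inner_symm y, ← sq] at h
  exact h

theorem apply_eq_zero_of_nonneg {A : H →L[ℂ] H} (hA : 0 ≤ A) {x : H}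
    (hx : inner ℂ (A x) x = 0) : A x = 0 := by
  have h := norm_inner_sq_le_of_nonneg hA x (A x)
  rw [hx, Complex.zero_re, zero_mul] at h
  have h' : ‖inner ℂ (A x) (A x)‖ = 0 := by
    have := norm_nonneg (inner ℂ (A x) (A x))
    nlinarith
  simpa using h'

theorem inner_eq_re_of_nonneg {A : H →L[ℂ] H} (hA : 0 ≤ A) (x : H) :
    ((inner ℂ (A x) x).re : ℂ) = inner ℂ (A x) x :=
  (Complex.eq_re_of_ofReal_le (r := 0) (by
    simpa using ContinuousLinearMap.nonneg_iff_forall.1 hA x)).symm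

/-- The effects below a one-dimensional projection are its multiples. -/
theorem eq_smul_rankOne_of_le {B : H →L[ℂ] H} {x : H} (hx : ‖x‖ = 1) (h0 : 0 ≤ B)
    (h : B ≤ rankOne ℂ x x) :
    ∃ c : unitInterval, B = ((c : ℝ) : ℂ) • rankOne ℂ x x := by
  have hle := ContinuousLinearMap.le_iff_forall.1 h
  have hnn := ContinuousLinearMap.nonneg_iff_forall.1 h0
  have hB := (ContinuousLinearMap.nonneg_iff_isPositive B).1 h0
  have hr := inner_eq_re_of_nonneg h0 x
  have hxx : inner ℂ x x = (1 : ℂ) := by rw [inner_self_eq_norm_sq_to_K, hx]; simp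
  set r := (inner ℂ (B x) x).re
  have hmem : r ∈ unitInterval := by
    constructor
    · have := hnn x
      rw [← hr] at this
      exact_mod_cast this
    · have := hle x
      rw [← hr, inner_rankOne_self, hxx] at this
      have := Complex.real_le_real.1 this
      simpa using this
  refine ⟨⟨r, hmem⟩, ContinuousLinearMap.ext_inner_self fun v => ?_⟩
  -- The part of `v` orthogonal to `x` has form value `0` under the projection, hence under `B`, so
  -- `B` kills it.
  have hBv : B v = inner ℂ x v • B x := by
    have hw : B (v - inner ℂ x v • x) = 0 := by
      refine apply_eq_zero_of_nonneg h0 (le_antisymm ((hle _).trans_eq ?_) (hnn _))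
      rw [inner_rankOne_self, inner_sub_right, inner_smul_right, hxx]
      simp
    rwa [map_sub, map_smul, sub_eq_zero] at hw
  have hBx : inner ℂ (B x) v = inner ℂ x v * (r : ℂ) := by
    rw [hB.inner_left_eq_inner_right, hBv, inner_smul_right, ← hB.inner_left_eq_inner_right, hr]
  rw [_root_.smul_apply, inner_smul_left, inner_rankOne_self]
  conv_lhs => rw [hBv, inner_smul_left, hBx]
  rw [Complex.conj_ofReal]
  push_cast
  linear_combination (r : ℂ) * RCLike.conj_mul (inner ℂ x v)

/-- Take `y = A v / √⟨A v, v⟩` with `A v ≠ 0`; the inequality is Cauchy–Schwarz for the form of `A`.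
-/
theorem exists_rankOne_le {A : H →L[ℂ] H} (hA : 0 ≤ A) (h : A ≠ 0) :
    ∃ y : H, y ≠ 0 ∧ rankOne ℂ y y ≤ A := by
  obtain ⟨v, hv⟩ : ∃ v, A v ≠ 0 := by
    by_contra! h'
    exact h (ContinuousLinearMap.ext h')
  have hr := inner_eq_re_of_nonneg hA v
  have h0 : (inner ℂ (A v) v).re ≠ 0 := by
    intro h0
    rw [h0, Complex.ofReal_zero] at hr
    exact hv (apply_eq_zero_of_nonneg hA hr.symm)
  have hr0 : 0 ≤ (inner ℂ (A v) v).re :=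
    (Complex.le_def.1 (ContinuousLinearMap.nonneg_iff_forall.1 hA v)).1
  have hcs := norm_inner_sq_le_of_nonneg hA v
  set r := (inner ℂ (A v) v).re
  refine ⟨(((Real.sqrt r)⁻¹ : ℝ) : ℂ) • A v, smul_ne_zero ?_ hv, ?_⟩
  · exact_mod_cast inv_ne_zero (Real.sqrt_ne_zero'.2 (lt_of_le_of_ne hr0 h0.symm))
  · rw [ContinuousLinearMap.le_iff_forall]
    intro w
    rw [inner_rankOne_self, ← inner_eq_re_of_nonneg hA w, Complex.real_le_real, inner_smul_left,
      norm_mul, mul_pow, Complex.conj_ofReal, Complex.norm_real, Real.norm_eq_abs, sq_abs, inv_pow,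
      Real.sq_sqrt hr0, inv_mul_le_iff₀ (lt_of_le_of_ne hr0 h0.symm)]
    exact hcs w

theorem smul_rankOne_le_iff {x : H} (hx : ‖x‖ = 1) {s t : ℝ} :
    (s : ℂ) • rankOne ℂ x x ≤ (t : ℂ) • rankOne ℂ x x ↔ s ≤ t := by
  constructor
  · intro h
    have := ContinuousLinearMap.le_iff_forall.1 h x
    simpa [inner_smul_left, hx, inner_self_eq_norm_sq_to_K, Complex.le_def] using this
  · intro h
    rw [HilbertEffect.le_iff_sub_nonneg]
    have := HilbertEffect.smul_nonneg' (rankOne_self_nonneg x) (sub_nonneg.2 h)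
    rwa [Complex.ofReal_sub, sub_smul] at this

theorem eq_smul_of_rankOne_eq {x y : H} (hx : ‖x‖ = 1) (hy : ‖y‖ = 1)
    (h : rankOne ℂ x x = rankOne ℂ y y) : ∃ z : ℂ, ‖z‖ = 1 ∧ y = z • x := by
  have h' : y = inner ℂ x y • x := by
    have := congrArg (fun T : H →L[ℂ] H => T y) h
    simpa [inner_self_eq_norm_sq_to_K, hy] using this.symm
  refine ⟨_, ?_, h'⟩
  have := congrArg norm h'
  rw [norm_smul, hx, hy, mul_one] at this
  exact this.symm

/-- If the projections onto the lines of the unit vectors `xᵢ` add up to the identity, then the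
`xᵢ` are orthonormal. -/
theorem orthonormal_of_sum_rankOne {ι : Type*} [Fintype ι] {x : ι → H} (hx : ∀ i, ‖x i‖ = 1)
    (h : ∑ i, rankOne ℂ (x i) (x i) = 1) : Orthonormal ℂ x := by
  classical
  refine ⟨hx, fun i j hij => ?_⟩
  have h1 := congrArg (fun T : H →L[ℂ] H => inner ℂ (T (x j)) (x j)) h
  simp only [_root_.sum_apply, sum_inner, inner_rankOne_self, one_apply_eq_self,
    inner_self_eq_norm_sq_to_K, hx] at h1
  have h2 : ∑ k, ‖inner ℂ (x k) (x j)‖ ^ 2 = (1 : ℝ) := by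
    apply Complex.ofReal_injective
    simpa using h1
  have hj : ‖inner ℂ (x j) (x j)‖ ^ 2 = (1 : ℝ) := by
    rw [inner_self_eq_norm_sq_to_K, hx]; simp
  -- The term at `j` already exhausts the total `1`, so the other terms vanish.
  rw [← Finset.add_sum_erase _ _ (Finset.mem_univ j), hj, add_eq_left,
    Finset.sum_eq_zero_iff_of_nonneg fun _ _ => by positivity] at h2
  simpa using h2 i (Finset.mem_erase.2 ⟨hij, Finset.mem_univ i⟩)

/-- Evaluate `|w⟩⟨w| ≤ 1` on the part of `v` orthogonal to `x`. -/
theorem rankOne_le_one_sub_rankOne {x w : H} (hx : ‖x‖ = 1) (hw : ‖w‖ ≤ 1)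
    (hxw : inner ℂ x w = (0 : ℂ)) : rankOne ℂ w w ≤ 1 - rankOne ℂ x x := by
  have hxx : inner ℂ x x = (1 : ℂ) := by rw [inner_self_eq_norm_sq_to_K, hx]; simp
  have hwx : inner ℂ w x = (0 : ℂ) := inner_eq_zero_symm.1 hxw
  rw [ContinuousLinearMap.le_iff_forall]
  intro v
  have h := ContinuousLinearMap.le_iff_forall.1 (rankOne_self_le_one hw) (v - inner ℂ x v • x)
  rw [inner_rankOne_self] at h ⊢
  rw [inner_sub_right, inner_smul_right, hwx, mul_zero, sub_zero] at h
  refine h.trans_eq ?_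
  rw [one_apply_eq_self, _root_.sub_apply, one_apply_eq_self, rankOne_apply]
  simp only [inner_sub_left, inner_sub_right, inner_smul_left, inner_smul_right, hxx,
    inner_conj_symm]
  ring

/-- A convexity inequality for rank-one operators. -/
theorem smul_rankOne_add_le {s : ℝ} (u w : H) :
    ((s * (1 - s) : ℝ) : ℂ) • rankOne ℂ (u + w) (u + w) ≤
      (s : ℂ) • rankOne ℂ u u + ((1 - s : ℝ) : ℂ) • rankOne ℂ w w := by
  rw [HilbertEffect.le_iff_sub_nonneg]
  -- The difference of the two sides is exactly this rank-one operator.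
  convert rankOne_self_nonneg ((s : ℂ) • u - ((1 - s : ℝ) : ℂ) • w) using 1
  ext v
  simp only [_root_.sub_apply, _root_.add_apply, _root_.smul_apply, rankOne_apply, inner_add_left,
    inner_sub_left, inner_smul_left, Complex.conj_ofReal]
  push_cast
  module

end Operators

namespace ConvexEffectAlgebra

open EffectAlgebra

/-! ### From a frame to completeness. -/

section Frames

variable {E : Type u} [ConvexEffectAlgebra E] {H : Type v} [NormedAddCommGroup H]
  [InnerProductSpace ℂ H] {κ : HatChoice E}
  {ψ : ∀ A : Context E, OrthonormalBasis A.carrier ℂ H}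

theorem IsFrame.isComplete (hψ : IsFrame κ ψ) : IsComplete κ := by
  have hvec : ∀ A a, (ψ A).repr.symm (A.vec a) = ψ A a := by
    intro A a
    classical
    rw [Context.vec_eq, EuclideanSpace.basisFun_apply, OrthonormalBasis.repr_symm_single]
  refine ⟨fun A B => (ψ A).repr.symm.trans (ψ B).repr, ⟨?_, ?_, ?_⟩, ?_⟩
  · intro A
    exact LinearIsometryEquiv.symm_trans_self _
  · intro A B
    rfl
  · intro A B C a c
    rw [LinearIsometryEquiv.trans_apply, LinearIsometryEquiv.trans_apply,
      LinearIsometryEquiv.inner_map_map, hvec, hvec]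
    exact hψ.transition A C a c
  · intro B x hx
    obtain ⟨A, a, z, hz, h⟩ := hψ.exhaust ((ψ B).repr.symm x) (by simpa using hx)
    refine ⟨A, a, z, hz, ?_⟩
    rw [LinearIsometryEquiv.trans_apply, hvec, h, map_smul, LinearIsometryEquiv.apply_symm_apply]

end Frames

/-! ### From an affine isomorphism onto `E(H)` to a frame and spectrality. -/

section HilbertianEffects

variable {E : Type u} [ConvexEffectAlgebra E] {H : Type v} [NormedAddCommGroup H]
  [InnerProductSpace ℂ H] [Nontrivial H] {φ : E → HilbertEffect H}

theorem IsAffineIso.injective (hφ : IsAffineIso φ) : Function.Injective φ :=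
  hφ.toIsMorphism.injective hφ.orth_of_map

theorem IsAffineIso.exists_eq (hφ : IsAffineIso φ) {T : H →L[ℂ] H} (h0 : 0 ≤ T) (h1 : T ≤ 1) :
    ∃ a, (φ a).1 = T := by
  obtain ⟨a, ha⟩ := hφ.surjective ⟨T, h0, h1⟩
  exact ⟨a, congrArg Subtype.val ha⟩

theorem IsAffineIso.isSum_iff (hφ : IsAffineIso φ) {a b c : E} :
    IsSum a b c ↔ (φ a).1 + (φ b).1 = (φ c).1 := by
  rw [← HilbertEffect.isSum_iff]
  refine ⟨hφ.toIsMorphism.map_isSum, fun h => ?_⟩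
  have hab := hφ.orth_of_map a b h.1
  exact ⟨hab, hφ.injective ((hφ.toIsMorphism.map_isSum ⟨hab, rfl⟩).eq h)⟩

theorem IsAffineIso.le_iff (hφ : IsAffineIso φ) {a b : E} : Le a b ↔ (φ a).1 ≤ (φ b).1 := by
  constructor
  · rintro ⟨c, hc⟩
    rw [HilbertEffect.le_iff_sub_nonneg, ← hφ.isSum_iff.1 hc, add_sub_cancel_left]
    exact (φ c).2.1
  · intro h
    have h1 : (φ b).1 - (φ a).1 ≤ 1 := by
      have h1 := (φ b).2.2
      rw [HilbertEffect.le_iff_sub_nonneg] at h1 ⊢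
      convert HilbertEffect.add_nonneg' h1 (φ a).2.1 using 1
      abel
    obtain ⟨c, hc⟩ := hφ.exists_eq (HilbertEffect.le_iff_sub_nonneg.1 h) h1
    exact ⟨c, hφ.isSum_iff.2 (by rw [hc, add_sub_cancel])⟩

theorem IsAffineIso.map_one_val (hφ : IsAffineIso φ) : (φ 1).1 = 1 := by
  rw [hφ.map_one, HilbertEffect.coe_one]

theorem IsAffineIso.map_zero_val (hφ : IsAffineIso φ) : (φ 0).1 = 0 := by
  rw [hφ.toIsMorphism.map_zero, HilbertEffect.coe_zero]

theorem IsAffineIso.map_smul_val (hφ : IsAffineIso φ) (c : unitInterval) (a : E) :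
    (φ (c • a)).1 = ((c : ℝ) : ℂ) • (φ a).1 := by
  rw [hφ.map_smul, HilbertEffect.coe_smul]

theorem IsAffineIso.map_orthosupp (hφ : IsAffineIso φ) (a : E) :
    (φ (orthosupp a)).1 = 1 - (φ a).1 := by
  rw [eq_sub_iff_add_eq', hφ.isSum_iff.1 (isSum_orthosupp a), hφ.map_one_val]

theorem IsAffineIso.zero_le (hφ : IsAffineIso φ) (a : E) : Le 0 a := by
  rw [hφ.le_iff, hφ.map_zero_val]
  exact (φ a).2.1

theorem IsAffineIso.isOneDimSharp_of_rankOne (hφ : IsAffineIso φ) {a : E} {x : H} (hx : ‖x‖ = 1)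
    (ha : (φ a).1 = rankOne ℂ x x) : IsOneDimSharp a := by
  have hx0 : x ≠ 0 := by rintro rfl; simp at hx
  have key : ∀ b, Le b a → ∃ c : unitInterval, b = c • a := by
    intro b hb
    rw [hφ.le_iff, ha] at hb
    obtain ⟨c, hc⟩ := eq_smul_rankOne_of_le hx (φ b).2.1 hb
    exact ⟨c, hφ.injective (Subtype.ext (by rw [hφ.map_smul_val, ha, hc]))⟩
  refine ⟨⟨⟨hφ.zero_le _, hφ.zero_le _⟩, fun b hb hb' => ?_⟩, ?_, key⟩
  · obtain ⟨c, rfl⟩ := key b hb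
    rw [hφ.le_iff, hφ.map_orthosupp, hφ.map_smul_val, ha] at hb'
    have h := ContinuousLinearMap.le_iff_forall.1 hb' x
    have hc : (c : ℝ) ≤ 0 := by
      simpa [inner_smul_left, inner_sub_left, hx, inner_self_eq_norm_sq_to_K, Complex.le_def]
        using h
    obtain rfl : c = 0 := Subtype.ext (le_antisymm hc c.2.1)
    rw [zero_smul']
    exact hφ.zero_le 0
  · rintro rfl
    rw [hφ.map_zero_val] at ha
    have := congrArg (fun T : H →L[ℂ] H => T x) ha
    simp [inner_self_eq_norm_sq_to_K, hx] at this
    exact hx0 this.symm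

/-- The image dominates some rank-one operator, so one-dimensionality makes it `μ P` with `P` a
rank-one projection and `0 < μ ≤ 1`. As `min μ (1 - μ) • P` lies below the images of both `a` and
`a'`, sharpness forces `μ = 1`. -/
theorem IsAffineIso.exists_rankOne (hφ : IsAffineIso φ) {a : E} (ha : IsOneDimSharp a) :
    ∃ x : H, ‖x‖ = 1 ∧ (φ a).1 = rankOne ℂ x x := by
  obtain ⟨hs, h0, h1⟩ := ha
  have hne : (φ a).1 ≠ 0 := fun h =>
    h0 (hφ.injective (Subtype.ext (h.trans hφ.map_zero_val.symm)))
  obtain ⟨y, hy, hya⟩ := exists_rankOne_le (φ a).2.1 hne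
  obtain ⟨b, hb⟩ := hφ.exists_eq (rankOne_self_nonneg y) (hya.trans (φ a).2.2)
  obtain ⟨c, rfl⟩ := h1 b (by rwa [hφ.le_iff, hb])
  rw [hφ.map_smul_val] at hb
  have hc : (c : ℝ) ≠ 0 := by
    intro hc
    rw [hc, Complex.ofReal_zero, zero_smul] at hb
    have := congrArg norm hb
    rw [norm_rankOne, norm_zero, zero_eq_mul_self] at this
    exact hy (norm_eq_zero.1 this)
  have hy' : ‖y‖ ≠ 0 := norm_ne_zero_iff.2 hy
  set x : H := ((‖y‖⁻¹ : ℝ) : ℂ) • y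
  have hx : ‖x‖ = 1 := by simp [x, norm_smul, hy']
  set μ : ℝ := ‖y‖ ^ 2 / c
  have hμ : (φ a).1 = (μ : ℂ) • rankOne ℂ x x := by
    have hc' : ((c : ℝ) : ℂ) ≠ 0 := by exact_mod_cast hc
    have hyc : (‖y‖ : ℂ) ≠ 0 := by exact_mod_cast hy'
    rw [rankOne_smul_self, ← hb, smul_smul, smul_smul]
    have : (μ : ℂ) * (((‖((‖y‖⁻¹ : ℝ) : ℂ)‖ ^ 2 : ℝ) : ℂ) * ((c : ℝ) : ℂ)) = 1 := by
      rw [Complex.norm_real, Real.norm_eq_abs, sq_abs]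
      simp only [μ]
      push_cast
      field_simp
    rw [← mul_assoc] at this
    rw [this, one_smul]
  have hμ0 : 0 < μ := div_pos (by positivity) (lt_of_le_of_ne c.2.1 hc.symm)
  have hμ1 : μ ≤ 1 := by
    have := ContinuousLinearMap.le_iff_forall.1 (φ a).2.2 x
    rw [hμ] at this
    simpa [inner_smul_left, hx, inner_self_eq_norm_sq_to_K, Complex.le_def] using this
  refine ⟨x, hx, ?_⟩
  obtain ⟨p, hp⟩ := hφ.exists_eq (rankOne_self_nonneg x) (rankOne_self_le_one hx.le)
  let t : unitInterval := ⟨min μ (1 - μ), le_min hμ0.le (by linarith), (min_le_left _ _).trans hμ1⟩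
  have ht := hs.2 (t • p) ?_ ?_
  · rw [hφ.le_iff, hφ.map_zero_val, hφ.map_smul_val, hp] at ht
    have h2 : (t : ℝ) ≤ 0 := by
      rw [← smul_rankOne_le_iff hx]
      simpa using ht
    have h3 : min μ (1 - μ) ≤ 0 := h2
    have h4 : μ = 1 := by
      rcases min_le_iff.1 h3 with h | h <;> linarith
    rw [hμ, h4, Complex.ofReal_one, one_smul]
  · rw [hφ.le_iff, hφ.map_smul_val, hp, hμ, smul_rankOne_le_iff hx]
    exact min_le_left _ _
  · rw [hφ.le_iff, hφ.map_smul_val, hp, hφ.map_orthosupp, hμ]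
    have h2 : ((t : ℝ) : ℂ) • rankOne ℂ x x ≤ ((1 - μ : ℝ) : ℂ) • rankOne ℂ x x :=
      (smul_rankOne_le_iff hx).2 (min_le_right _ _)
    have h3 := rankOne_self_le_one hx.le
    rw [HilbertEffect.le_iff_sub_nonneg] at h2 h3 ⊢
    convert HilbertEffect.add_nonneg' h2 h3 using 1
    push_cast
    module

/-- A unit vector that spans the range of the projection attached to a one-dimensional sharp
effect. -/
noncomputable def IsAffineIso.ray (hφ : IsAffineIso φ) {a : E} (ha : IsOneDimSharp a) : H :=
  (hφ.exists_rankOne ha).choose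

theorem IsAffineIso.norm_ray (hφ : IsAffineIso φ) {a : E} (ha : IsOneDimSharp a) :
    ‖hφ.ray ha‖ = 1 :=
  (hφ.exists_rankOne ha).choose_spec.1

theorem IsAffineIso.map_eq_rankOne (hφ : IsAffineIso φ) {a : E} (ha : IsOneDimSharp a) :
    (φ a).1 = rankOne ℂ (hφ.ray ha) (hφ.ray ha) :=
  (hφ.exists_rankOne ha).choose_spec.2

theorem IsAffineIso.sum_rankOne_ray (hφ : IsAffineIso φ) (A : Context E) :
    ∑ a : A.carrier, rankOne ℂ (hφ.ray (A.isOneDimSharp a a.2)) (hφ.ray (A.isOneDimSharp a a.2))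
      = 1 := by
  rw [← hφ.map_one_val, HilbertEffect.map_isOrthoSum hφ.toIsMorphism A.sum_eq_one]
  refine (Finset.sum_congr rfl fun a _ => (hφ.map_eq_rankOne _).symm).trans ?_
  exact Finset.sum_coe_sort A.carrier fun a => (φ a).1

/-- The orthonormal basis attached to a context. -/
noncomputable def IsAffineIso.basis (hφ : IsAffineIso φ) (A : Context E) :
    OrthonormalBasis A.carrier ℂ H :=
  OrthonormalBasis.mk (v := fun a : A.carrier => hφ.ray (A.isOneDimSharp a a.2))
    (orthonormal_of_sum_rankOne (fun _ => hφ.norm_ray _) (hφ.sum_rankOne_ray A))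
    (by
      intro v _
      have h := congrArg (fun T : H →L[ℂ] H => T v) (hφ.sum_rankOne_ray A)
      simp only [_root_.sum_apply, one_apply_eq_self, rankOne_apply] at h
      rw [← h]
      exact Submodule.sum_mem _ fun a _ =>
        Submodule.smul_mem _ _ (Submodule.subset_span ⟨a, rfl⟩))

theorem IsAffineIso.basis_apply (hφ : IsAffineIso φ) (A : Context E) (a : A.carrier) :
    hφ.basis A a = hφ.ray (A.isOneDimSharp a a.2) := by
  rw [IsAffineIso.basis, OrthonormalBasis.coe_mk]

theorem IsAffineIso.map_eq_rankOne_basis (hφ : IsAffineIso φ) (A : Context E) (a : A.carrier) :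
    (φ a).1 = rankOne ℂ (hφ.basis A a) (hφ.basis A a) := by
  rw [hφ.basis_apply, ← hφ.map_eq_rankOne]

/-- Every orthonormal basis of `H` comes from a context. -/
theorem IsAffineIso.exists_context (hφ : IsAffineIso φ) {ι : Type*} [Fintype ι]
    (e : OrthonormalBasis ι ℂ H) :
    ∃ (A : Context E) (f : ι ↪ E), A.carrier = Finset.univ.map f ∧
      ∀ i, (φ (f i)).1 = rankOne ℂ (e i) (e i) := by
  classical
  choose f hf using fun i => hφ.exists_eq (rankOne_self_nonneg (e i))
    (rankOne_self_le_one (e.norm_eq_one i).le)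
  have hinj : Function.Injective f := by
    intro i j hij
    by_contra hne
    have hr : rankOne ℂ (e i) (e i) = rankOne ℂ (e j) (e j) := by rw [← hf, ← hf, hij]
    have h := congrArg (fun T : H →L[ℂ] H => T (e i)) hr
    simp only [rankOne_apply, e.inner_eq_ite, if_neg (Ne.symm hne)] at h
    simp only [if_true, one_smul, zero_smul] at h
    have := e.norm_eq_one i
    rw [h, norm_zero] at this
    exact zero_ne_one this
  have hsum : ((Finset.univ.val.map f).map fun a => (φ a).1).sum = 1 := by
    rw [Multiset.map_map]
    exact (Finset.sum_congr rfl fun i _ => hf i).trans e.sum_rankOne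
  obtain ⟨s, hs, hs'⟩ := HilbertEffect.exists_isOrthoSum hφ.toIsMorphism hφ.orth_of_map
    (hsum.trans_le le_rfl)
  obtain rfl : s = 1 :=
    hφ.injective (Subtype.ext ((hs'.trans hsum).trans hφ.map_one_val.symm))
  refine ⟨⟨Finset.univ.map ⟨f, hinj⟩, ?_, hs⟩, ⟨f, hinj⟩, rfl, hf⟩
  intro a ha
  obtain ⟨i, -, rfl⟩ := Finset.mem_map.1 ha
  exact hφ.isOneDimSharp_of_rankOne (e.norm_eq_one i) (hf i)

theorem IsAffineIso.isSpectral [FiniteDimensional ℂ H] (hφ : IsAffineIso φ) : IsSpectral E := by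
  intro b
  obtain ⟨e, c, hb⟩ := exists_eq_sum_smul_rankOne (φ b).2.1 (φ b).2.2
  obtain ⟨A, f, hA, hf⟩ := hφ.exists_context e
  -- Spectrality wants coefficients on all of `E`; those off the context are irrelevant.
  let c' : E → unitInterval := Function.extend f c 0
  have hsum : ((A.carrier.val.map fun a => c' a • a).map fun a => (φ a).1).sum = (φ b).1 := by
    rw [Multiset.map_map, hA, hb]
    change ∑ a ∈ Finset.univ.map f, (φ (c' a • a)).1 = _
    rw [Finset.sum_map]
    refine Finset.sum_congr rfl fun i _ => ?_
    rw [hφ.map_smul_val, hf, show c' (f i) = c i from f.injective.extend_apply c 0 i]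
  obtain ⟨s, hs, hs'⟩ := HilbertEffect.exists_isOrthoSum hφ.toIsMorphism hφ.orth_of_map
    (hsum.trans_le (φ b).2.2)
  obtain rfl : s = b := hφ.injective (Subtype.ext (hs'.trans hsum))
  exact ⟨A, c', hs⟩

/-- A state that is `1` at a one-dimensional projection is bounded by the vector state there. -/
theorem IsAffineIso.state_le (hφ : IsAffineIso φ) {a c : E} {x y : H} (hx : ‖x‖ = 1)
    (hy : ‖y‖ = 1) (ha : (φ a).1 = rankOne ℂ x x) (hc : (φ c).1 = rankOne ℂ y y) {ω : State E}
    (hω : ω.1 a = 1) : (ω.1 c : ℝ) ≤ ‖inner ℂ x y‖ ^ 2 := by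
  have hxx : inner ℂ x x = (1 : ℂ) := by rw [inner_self_eq_norm_sq_to_K, hx]; simp
  set α := inner ℂ x y
  set w := y - α • x
  have hxw : inner ℂ x w = (0 : ℂ) := by
    rw [inner_sub_right, inner_smul_right, hxx, mul_one, sub_self]
  have hα : ‖α‖ ≤ 1 := by simpa [hx, hy] using norm_inner_le_norm (𝕜 := ℂ) x y
  have hw : ‖w‖ ≤ 1 := by
    have h1 : ‖y‖ * ‖y‖ = ‖α • x‖ * ‖α • x‖ + ‖w‖ * ‖w‖ := by
      rw [← norm_add_sq_eq_norm_sq_add_norm_sq_of_inner_eq_zero (𝕜 := ℂ) (α • x) w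
        (by rw [inner_smul_left, hxw, mul_zero]), add_sub_cancel]
    rw [hy] at h1
    nlinarith [norm_nonneg w, mul_self_nonneg ‖α • x‖]
  obtain ⟨d, hd⟩ := hφ.exists_eq (rankOne_self_nonneg w) (rankOne_self_le_one hw)
  -- Since `w ⊥ x`, the effect `d` lies below `a'`, where `ω` vanishes.
  have hωd : (ω.1 d : ℝ) = 0 := by
    have h1 : Le d (orthosupp a) := by
      rw [hφ.le_iff, hφ.map_orthosupp, hd, ha]
      exact rankOne_le_one_sub_rankOne hx hw hxw
    have h2 := State.mono (ω := ω) h1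
    have h3 := State.add (ω := ω) (isSum_orthosupp a)
    rw [hω, ω.2.map_one] at h3
    refine le_antisymm (h2.trans ?_) (ω.1 d).2.1
    linarith
  let r : unitInterval := ⟨‖α‖ ^ 2, by positivity, pow_le_one₀ (norm_nonneg _) hα⟩
  -- As `y = α x + w`, the convexity inequality bounds `s (1 - s) c` by `s |α|² a ⊕ (1 - s) d`.
  -- Applying `ω` and dividing by `s` leaves `(1 - s) ω(c) ≤ |α|²`.
  have key : ∀ s : ℝ, 0 < s → s < 1 → (ω.1 c : ℝ) ≤ ‖α‖ ^ 2 + s := by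
    intro s hs0 hs1
    let s₁ : unitInterval := ⟨s, hs0.le, hs1.le⟩
    obtain ⟨q, hq, -⟩ := (isSum_smul_add (α := s₁) (β := unitInterval.symm s₁) (γ := 1) (1 : E)
      (by simp)).mono (isSum_smul s₁ (isSum_orthosupp (r • a))).le
      (isSum_smul (unitInterval.symm s₁) (isSum_orthosupp d)).le
    have hle : Le ((s₁ * unitInterval.symm s₁) • c) q := by
      rw [hφ.le_iff, ← hφ.isSum_iff.1 hq]
      simp only [hφ.map_smul_val, ha, hd, hc]
      have h := smul_rankOne_add_le (s := s) (α • x) w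
      rw [add_sub_cancel, rankOne_smul_self] at h
      exact h
    have h1 := State.mono (ω := ω) hle
    rw [State.add hq] at h1
    simp only [state_smul, hωd, hω] at h1
    have h2 : s * (1 - s) * (ω.1 c : ℝ) ≤ s * (‖α‖ ^ 2 * 1) + (1 - s) * 0 := h1
    have h3 : (1 - s) * (ω.1 c : ℝ) ≤ ‖α‖ ^ 2 := by
      refine le_of_mul_le_mul_left ?_ hs0
      linarith
    nlinarith [(ω.1 c).2.2]
  refine le_of_forall_pos_le_add fun s hs => ?_
  rcases lt_or_ge s 1 with h | h
  · exact key s hs h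
  · have := (ω.1 c).2.2
    nlinarith [sq_nonneg ‖α‖]

/-- Over the context `C`, the values of `â` sum to `1` because it is a state, and the squared inner
products by Parseval. The termwise bound `IsAffineIso.state_le` is therefore an equality. For
exhaustion, a unit vector is extended to an orthonormal basis, which comes from a context. -/
theorem IsAffineIso.isFrame (hφ : IsAffineIso φ) [FiniteDimensional ℂ H] (κ : HatChoice E) :
    IsFrame κ hφ.basis where
  transition A C a c := by
    have hle : ∀ d ∈ (Finset.univ : Finset C.carrier),
        ((A.hat κ a).1 d : ℝ) ≤ ‖inner ℂ (hφ.basis A a) (hφ.basis C d)‖ ^ 2 := fun d _ =>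
      hφ.state_le ((hφ.basis A).norm_eq_one a) ((hφ.basis C).norm_eq_one d)
        (hφ.map_eq_rankOne_basis A a) (hφ.map_eq_rankOne_basis C d) (κ.hat_self _ _)
    have h1 : ∑ d : C.carrier, ((A.hat κ a).1 d : ℝ) = 1 := by
      have := Context.state_eq_sum (A.hat κ a) C.isOrthoSum_one
      rw [(A.hat κ a).2.map_one] at this
      simpa using this.symm
    have h2 : ∑ d : C.carrier, ‖inner ℂ (hφ.basis A a) (hφ.basis C d)‖ ^ 2 = 1 := by
      rw [(hφ.basis C).sum_sq_norm_inner_left, (hφ.basis A).norm_eq_one]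
      norm_num
    exact ((Finset.sum_eq_sum_iff_of_le hle).1 (h1.trans h2.symm) c (Finset.mem_univ c)).symm
  exhaust x hx := by
    obtain ⟨s, e, hs, he⟩ := Orthonormal.exists_orthonormalBasis_extension (𝕜 := ℂ) (v := {x})
      (by simpa [orthonormal_iff_ite] using hx)
    obtain ⟨A, f, hA, hf⟩ := hφ.exists_context e
    let i : s := ⟨x, hs rfl⟩
    have hi : f i ∈ A.carrier := by rw [hA]; simp
    have h := hφ.map_eq_rankOne_basis A ⟨f i, hi⟩
    rw [hf, he] at h
    exact ⟨A, ⟨f i, hi⟩, eq_smul_of_rankOne_eq hx ((hφ.basis A).norm_eq_one _) h⟩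

/-- The vector state of a unit vector. -/
noncomputable def IsAffineIso.vectorState (hφ : IsAffineIso φ) {x : H} (hx : ‖x‖ = 1) : State E :=
  ⟨fun b => ⟨(inner ℂ ((φ b).1 x) x).re,
    (Complex.le_def.1 (ContinuousLinearMap.nonneg_iff_forall.1 (φ b).2.1 x)).1, by
      have h := (Complex.le_def.1 (ContinuousLinearMap.le_iff_forall.1 (φ b).2.2 x)).1
      simpa [inner_self_eq_norm_sq_to_K, hx] using h⟩,
   { map_osum := fun a b h => by
       have hs := hφ.isSum_iff.1 (⟨h, rfl⟩ : IsSum a b (osum a b h))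
       have hv : (inner ℂ ((φ (osum a b h)).1 x) x).re =
           (inner ℂ ((φ a).1 x) x).re + (inner ℂ ((φ b).1 x) x).re := by
         rw [← hs, _root_.add_apply, inner_add_left, Complex.add_re]
       refine ⟨?_, Subtype.ext hv⟩
       change (inner ℂ ((φ a).1 x) x).re + (inner ℂ ((φ b).1 x) x).re ≤ 1
       rw [← hv]
       have h := (Complex.le_def.1
         (ContinuousLinearMap.le_iff_forall.1 (φ (osum a b h)).2.2 x)).1
       simpa [inner_self_eq_norm_sq_to_K, hx] using h
     map_one := Subtype.ext (by
       change (inner ℂ ((φ 1).1 x) x).re = 1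
       rw [hφ.map_one_val]
       simp [inner_self_eq_norm_sq_to_K, hx]) }⟩

/-- Needed for the form of the theorem that asks for completeness under some choice of states. -/
theorem IsAffineIso.nonempty_hatChoice (hφ : IsAffineIso φ) : Nonempty (HatChoice E) :=
  ⟨{ hat := fun _ ha => hφ.vectorState (hφ.norm_ray ha)
     hat_self := fun a ha => Subtype.ext (by
       change (inner ℂ ((φ a).1 (hφ.ray ha)) (hφ.ray ha)).re = 1
       rw [hφ.map_eq_rankOne ha, inner_rankOne_self, inner_self_eq_norm_sq_to_K, hφ.norm_ray]
       simp) }⟩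

end HilbertianEffects

variable {E : Type u} [ConvexEffectAlgebra E]

theorem isComplete_of_isHilbertian (hE : IsFiniteDimensional E) (h : IsHilbertian.{u, v} E) :
    Nonempty (HatChoice E) ∧ (∀ κ : HatChoice E, IsComplete κ) ∧ IsSpectral E := by
  obtain ⟨A⟩ := hE
  obtain ⟨H, _, _, _, _, φ, hφ⟩ := h
  have : FiniteDimensional ℂ H := (hφ.basis A).toBasis.finiteDimensional_of_finite
  exact ⟨hφ.nonempty_hatChoice, fun κ => (hφ.isFrame κ).isComplete, hφ.isSpectral⟩

end ConvexEffectAlgebra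

end

theorem theorem3p3 {E : Type u} [ConvexEffectAlgebra E]
    (hE : ConvexEffectAlgebra.IsFiniteDimensional E) :
    (IsHilbertian.{u, v} E ↔
      (∃ κ : ConvexEffectAlgebra.HatChoice E, ConvexEffectAlgebra.IsComplete κ) ∧
        ConvexEffectAlgebra.IsSpectral E) ∧
    ∀ κ : ConvexEffectAlgebra.HatChoice E,
      (IsHilbertian.{u, v} E ↔
        ConvexEffectAlgebra.IsComplete κ ∧ ConvexEffectAlgebra.IsSpectral E) := by
  refine ⟨⟨fun h => ?_, ?_⟩, fun κ => ⟨fun h => ?_, ?_⟩⟩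
  · obtain ⟨⟨κ⟩, hκ, hS⟩ := ConvexEffectAlgebra.isComplete_of_isHilbertian hE h
    exact ⟨⟨κ, hκ κ⟩, hS⟩
  · rintro ⟨⟨κ, hκ⟩, hS⟩
    exact ConvexEffectAlgebra.isHilbertian_of_isComplete hE hκ hS
  · obtain ⟨-, hκ, hS⟩ := ConvexEffectAlgebra.isComplete_of_isHilbertian hE h
    exact ⟨hκ κ, hS⟩
  · rintro ⟨hκ, hS⟩
    exact ConvexEffectAlgebra.isHilbertian_of_isComplete hE hκ hS
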